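/- Let $\mathbb{H}^+=\{x+\mathrm{i}y : x\ge 0,\ y\in\mathbb{R}\}$, regarded as a half-plane in $\mathbb{R}^3$ bounded by the axis of revolution (the $y$-axis, i.e. the imaginary axis), and let $\mathbf{R}_\phi$ be the rotation of $\mathbb{R}^3$ by the angle $\phi$ about this axis. For $s>0$ put $$\mathcal{K}_s(z,w):=\frac1{2\pi}\int_0^{2\pi}\frac{\mathrm{d}\phi}{|\mathbf{R}_\phi z-w|^{s}}\in[0,\infty],$$ and let $w_*:=-\overline{w}$ be the reflection of $w$ in the imaginary axis. (The definition also makes sense for $w_*$ in place of $z$.) Unless said otherwise, $s>0$ and $z,w\in\mathbb{H}^+$. 1. $\mathcal{K}_s(z,w)$ is finite for $z\ne w$. 2. $\mathcal{K}_s(z,w)=\mathcal{K}_s(w,z)$. 3. $\mathcal{K}_s(rz,rw)=r^{-s}\mathcal{K}_s(z,w)$ for all $r>0$. 4. $\mathcal{K}_s$ is continuous on $\mathbb{H}^+\times\mathbb{H}^+$ at every $(z,w)$ with $z\neq w$. If $0<s<1$, it is finite and continuous at $(w,w)$ whenever $\operatorname{Re}w>0$. If $s\ge1$, it is singular on the diagonal: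 for every $w\in\mathbb{H}^+$, $\mathcal{K}_s(w,w)=\infty$, and $\mathcal{K}_s(z',w')\to\infty$ as $(z',w')\to(w,w)$ in $\mathbb{H}^+\times\mathbb{H}^+$, $z'\ne w'$. 5. If $\operatorname{Re}w=0$, then $\mathcal{K}_s(z,w)=|z-w|^{-s}$ for $z\ne w$. If $\operatorname{Re}w>0$ and $s>1$, then $$|z-w|^{s-1}\mathcal{K}_s(z,w)\to\frac{\Gamma((s-1)/2)}{\sqrt\pi\,\Gamma(s/2)}\,\frac1{|w-w_*|}\qquad(z\to w,\ z\neq w).$$ 6. For $u\ge0$, $\mathcal{K}_s(u+\mathrm{i}t,u+\mathrm{i}v)$ is strictly decreasing in $|t-v|$, and $\mathcal{K}_s(u+\mathrm{i}y,u+t+\mathrm{i}y)$ is strictly decreasing in $t>0$. 7. Let $0<s<1$ and $\operatorname{Re}w>0$. Then $\mathcal{K}_s(z,w)<\mathcal{K}_s(w,w)$ for all $z\in\mathbb{H}^+$, $z\ne w$, and $$\mathcal{K}_s(w,w)=\mathcal{K}_s(w_*,w)=\mathcal{I}_s\,|\operatorname{Re}w|^{-s},$$ where $\mathcal{I}_s=\iint|x-y|^{-s}\,\mathrm{d}\sigma(x)\,\mathrm{d}\sigma(y)$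 is the Riesz $s$-energy of the uniform probability measure $\sigma=\mathrm{d}\phi/(2\pi)$ on the unit circle, and $$\mathcal{I}_s=2^{-s}\frac{\Gamma((1-s)/2)}{\sqrt\pi\,\Gamma(1-s/2)}=\frac{\Gamma(1-s)}{[\Gamma(1-s/2)]^2}.$$ 8. Let $z\neq w$, or $z=w$ with $0<s<1$ and $\operatorname{Re}w>0$. Then $$\mathcal{K}_s(z,w)=|z-w_*|^{-s}\,{}_2F_1\!\Big(\frac s2,\frac12;1;1-\frac{|z-w|^2}{|z-w_*|^2}\Big) =\Big\{\frac2{|z-w_*|+|z-w|}\Big\}^{s}{}_2F_1\!\Big(\frac s2,\frac s2;1;\Big\{\frac{|z-w_*|-|z-w|}{|z-w_*|+|z-w|}\Big\}^2\Big).$$ If $z\ne w$, then also $$\mathcal{K}_s(z,w)=|z-w_*|^{-s/2}|z-w|^{-s/2}\,P^0_{s/2-1}(X),\qquad X=\frac12\frac{|z-w|}{|z-w_*|}+\frac12\frac{|z-w_*|}{|z-w|},$$ where $P^0_\nu$ is the Legendre function of the first kind, i.e. the analytic continuation to $(-1,\infty)$ (which exists) of $x\mapsto{}_2F_1(-\nu,\nu+1;1;(1-x)/2)$,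 $|1-x|<2$. Here $X>1$ if $\operatorname{Re}z>0$, $\operatorname{Re}w>0$ and $z\neq w$. For $s>1$ and $z\ne w$, $$\mathcal{K}_s(z,w)=\frac{|z-w|^{1-s}}{|z-w_*|}\,{}_2F_1\!\Big(1-\frac s2,\frac12;1;1-\frac{|z-w|^2}{|z-w_*|^2}\Big).$$ 9. If $z\ne w$, or $z=w$ with $\operatorname{Re}w>0$, then $$\lim_{s\to0^+}\frac{\mathcal{K}_s(z,w)-1}{s}=\log\frac{2}{|z-w|+|z-w_*|}.$$ 10. For $z\neq w$, as $s\to1^-$, $\mathcal{K}_s(z,w)\to\mathcal{K}_1(z,w)$, and $$\mathcal{K}_1(z,w)=\frac2\pi\,\frac2{|z-w_*|+|z-w|}\,\mathbf{K}\!\Big(\Big\{\frac{|z-w_*|-|z-w|}{|z-w_*|+|z-w|}\Big\}^2\Big),\qquad \mathbf{K}(k^2)=\int_0^{\pi/2}\frac{\mathrm{d}\vartheta}{\sqrt{1-k^2\sin^2\vartheta}}.$$ If $\operatorname{Re}w>0$, then $\mathcal{K}_s(w,w)\to\infty$ as $s\to1^-$. -/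

import Mathlib

open Set Filter Topology MeasureTheory
open scoped ENNReal

noncomputable section

namespace RieszRev

/-- The closed right half-plane, a cutting half-plane of the solid of revolution. -/
def halfPlane : Set ℂ := {z | 0 ≤ z.re}

/-- The reflection of `w` in the imaginary axis: `u + iv ↦ -u + iv`. -/
def reflect (w : ℂ) : ℂ := -(starRingEnd ℂ w)

/-- The reference plane inside three-dimensional Euclidean space; the imaginary axis of `ℂ` becomes
the second coordinate axis, which is the axis of revolution. -/
def embed (z : ℂ) : EuclideanSpace ℝ (Fin 3) := !₂[z.re, z.im, 0]

/-- Rotation by the angle `φ` about the second coordinate axis. -/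
def rot (φ : ℝ) (p : EuclideanSpace ℝ (Fin 3)) : EuclideanSpace ℝ (Fin 3) :=
  !₂[Real.cos φ * p 0 + Real.sin φ * p 2, p 1, -Real.sin φ * p 0 + Real.cos φ * p 2]

/-- The kernel `(2π)⁻¹ ∫₀^{2π} |R_φ z - w|⁻ˢ dφ` as an integral with values in `[0, ∞]`. -/
def extKernel (s : ℝ) (z w : ℂ) : ℝ≥0∞ :=
  ENNReal.ofReal (2 * Real.pi)⁻¹ *
    ∫⁻ φ in Ico 0 (2 * Real.pi), ‖rot φ (embed z) - embed w‖ₑ ^ (-s)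

/-- The real value of the kernel, meaningful wherever `extKernel` is finite. -/
def kernel (s : ℝ) (z w : ℂ) : ℝ := (extKernel s z w).toReal

/-- The Riesz `s`-energy `∬ |x - y|⁻ˢ dμ(x) dμ(y)` of a measure on the plane. -/
def rieszEnergy (s : ℝ) (μ : Measure ℂ) : ℝ≥0∞ := ∫⁻ x, ∫⁻ y, ‖x - y‖ₑ ^ (-s) ∂μ ∂μ

/-- The uniform probability measure `dφ / 2π` on the unit circle. -/
def circleMeasure : Measure ℂ :=
  ENNReal.ofReal (2 * Real.pi)⁻¹ • (volume.restrict (Ico 0 (2 * Real.pi))).map (circleMap 0 1)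

/-- The complete elliptic integral of the first kind as a function of the parameter `m = k²`. -/
def ellipticK (m : ℝ) : ℝ := ∫ θ in (0 : ℝ)..(Real.pi / 2), 1 / √(1 - m * Real.sin θ ^ 2)

/-- `P` is, on `(-1, ∞)`, the Legendre function of the first kind of degree `ν` and order `0`:
the analytic continuation of `₂F₁(-ν, ν + 1; 1; (1 - x) / 2)`, whose series converges for
`|1 - x| < 2`. (These conditions determine `P` on the interval `(-1, ∞)`.) -/
def IsLegendreP (ν : ℝ) (P : ℝ → ℝ) : Prop :=
  AnalyticOnNhd ℝ P (Ioi (-1)) ∧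
    ∀ x : ℝ, |1 - x| < 2 → P x = ₂F₁ (-ν) (ν + 1) (1 : ℝ) ((1 - x) / 2)

/-- The point `(|z - w| / |z - w_*| + |z - w_*| / |z - w|) / 2` where the Legendre function
is evaluated. -/
def legendreArg (z w : ℂ) : ℝ :=
  1 / 2 * (‖z - w‖ / ‖z - reflect w‖) + 1 / 2 * (‖z - reflect w‖ / ‖z - w‖)

/-- The quotient `(|z - w_*| - |z - w|) / (|z - w_*| + |z - w|)`. -/
def modulus (z w : ℂ) : ℝ :=
  (‖z - reflect w‖ - ‖z - w‖) / (‖z - reflect w‖ + ‖z - w‖)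

end RieszRev

end

namespace RieszRev

/-! ### Binomial series and the series `₂F₁ α β 1` -/

open Ring (multichoose)

/-! The squared distance from `R_φ z` to `w` is `a² cos² (φ/2) + b² sin² (φ/2)` with `a = |z - w|`
and `b = |z - w_*|` (`norm_rot_embed_sub_sq`). The kernel is therefore a function `mean s a b` of
two distances, and `a ≤ b` on the half-plane. Symmetry, homogeneity and monotonicity along lines
follow directly from this.

The rest comes from two expansions of the mean. Taking out `b²` and expanding binomially, the Wallis
moments of `sin² (φ/2)` give `₂F₁(s/2, 1/2; 1; 1 - a²/b²)` (`toReal_mean_eq`). Euler's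
transformation extracts the factor `(a/b)^(1-s)`; for `s > 1` what remains has a finite limit at
argument `1`, which is the growth rate at the diagonal.

Taking out `((a+b)/2)²` instead turns the quadratic form into `|1 - m e^{iφ}|²` with `m =
(b-a)/(b+a)`, and Parseval's identity gives `₂F₁(s/2, s/2; 1; m²)`, whose coefficients `((s/2)_n /
n!)²` are nonnegative (`mean_eq_ofReal_hypergeometric`). For `s < 1` they are summable, so this
formula reaches the diagonal `m = 1`: hence continuity there, the strict maximum, and, since all
terms after the first are `O(s²)`, the limit `s → 0⁺`. Pfaff's transformation identifies the same
series with the Legendre function.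

On the diagonal the mean is a Beta integral, infinite for `s ≥ 1`; Fatou's lemma carries this
divergence to nearby points. -/

theorem factorial_mul_multichoose (σ : ℝ) (n : ℕ) :
    (n.factorial : ℝ) * multichoose σ n = (ascPochhammer ℝ n).eval σ := by
  rw [← Polynomial.ascPochhammer_smeval_eq_eval, ← Ring.factorial_nsmul_multichoose_eq_ascPochhammer,
    nsmul_eq_mul]

theorem multichoose_eq_div (σ : ℝ) (n : ℕ) :
    multichoose σ n = (ascPochhammer ℝ n).eval σ / n.factorial := by
  rw [← factorial_mul_multichoose]
  field_simp

theorem multichoose_succ (σ : ℝ) (n : ℕ) :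
    multichoose σ (n + 1) = multichoose σ n * ((σ + n) / (n + 1)) := by
  rw [multichoose_eq_div, multichoose_eq_div, ascPochhammer_succ_eval, Nat.factorial_succ]
  push_cast
  field_simp

theorem multichoose_pos {σ : ℝ} (hσ : 0 < σ) (n : ℕ) : 0 < multichoose σ n := by
  induction n with
  | zero => simp
  | succ n ih => rw [multichoose_succ]; positivity

theorem multichoose_nonneg {σ : ℝ} (hσ : 0 ≤ σ) (n : ℕ) : 0 ≤ multichoose σ n := by
  induction n with
  | zero => simp
  | succ n ih => rw [multichoose_succ]; positivity

theorem abs_multichoose_le {σ τ : ℝ} (h : |σ| ≤ τ) (n : ℕ) :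
    |multichoose σ n| ≤ multichoose τ n := by
  induction n with
  | zero => simp
  | succ n ih =>
    rw [multichoose_succ, multichoose_succ, abs_mul, abs_div, abs_of_pos (by positivity : (0 : ℝ) < n + 1)]
    have : |σ + n| ≤ τ + n := (abs_add_le _ _).trans (by simpa using h)
    have := multichoose_nonneg ((abs_nonneg σ).trans h) n
    gcongr

/-- Both sides are `(σ)_{k+j} / (k! j!)`, because `(σ)_k (σ+k)_j = (σ)_{k+j}`. -/
theorem multichoose_mul_multichoose_add (σ : ℝ) (k j : ℕ) :
    multichoose σ k * multichoose (σ + k) j = multichoose σ (k + j) * (k + j).choose k := by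
  have h := congrArg (Polynomial.eval σ) (ascPochhammer_mul ℝ k j)
  rw [Polynomial.eval_mul, Polynomial.eval_comp] at h
  simp only [Polynomial.eval_add, Polynomial.eval_X, Polynomial.eval_natCast] at h
  rw [multichoose_eq_div, multichoose_eq_div, multichoose_eq_div, ← h,
    Nat.cast_choose ℝ (Nat.le_add_right k j), Nat.add_sub_cancel_left]
  field_simp

/-- The Chu–Vandermonde identity in the form needed for Pfaff's transformation. -/
theorem sum_antidiagonal_choose_mul_multichoose (α : ℝ) (n : ℕ) :
    ∑ p ∈ Finset.HasAntidiagonal.antidiagonal n,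
      ((p.1 + p.2).choose p.1 : ℝ) * ((-1) ^ p.1 * multichoose (1 - α) p.1) = multichoose α n := by
  -- `multichoose α n` is the binomial coefficient of `(α - 1) + n` over `n`. Vandermonde splits it,
  -- and the upper entry `α - 1 = -(1 - α)` produces the sign `(-1)^k`.
  rw [Ring.multichoose_eq, show α + n - 1 = (α - 1) + n by ring,
    Ring.add_choose_eq n (Commute.all _ _)]
  refine Finset.sum_congr rfl fun p hp => ?_
  have hp' : p.1 + p.2 = n := Finset.HasAntidiagonal.mem_antidiagonal.1 hp
  rw [Ring.choose_natCast, hp', ← hp', Nat.choose_symm_add,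
    show α - 1 = -(1 - α) by ring, Ring.choose_neg', mul_comm]
  congr 1
  simp [Int.negOnePow_def, Units.smul_def]

theorem hasSum_multichoose_complex (σ : ℝ) {z : ℂ} (hz : ‖z‖ < 1) :
    HasSum (fun n : ℕ => ((multichoose σ n : ℝ) : ℂ) * z ^ n) ((1 - z) ^ (-σ : ℂ)) := by
  have h := (Complex.one_div_one_sub_cpow_hasFPowerSeriesOnBall_zero (σ : ℂ)).hasSum (y := z)
    (by simpa [← ofReal_norm] using hz)
  rw [zero_add, one_div, ← Complex.cpow_neg] at h
  refine h.congr_fun fun n => ?_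
  rw [FormalMultilinearSeries.ofScalars_apply_eq, ← Ring.multichoose_eq, smul_eq_mul]
  congr 1
  exact Ring.map_multichoose (algebraMap ℝ ℂ) σ n

theorem hasSum_multichoose (σ : ℝ) {x : ℝ} (hx : |x| < 1) :
    HasSum (fun n : ℕ => multichoose σ n * x ^ n) ((1 - x) ^ (-σ)) := by
  have h := (Real.one_div_one_sub_rpow_hasFPowerSeriesOnBall_zero σ).hasSum (y := x)
    (by simpa [← ofReal_norm] using hx)
  have h1 : 0 ≤ 1 - x := by linarith [(abs_lt.1 hx).2]
  rw [zero_add, one_div, ← Real.rpow_neg h1] at h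
  simpa [FormalMultilinearSeries.ofScalars_apply_eq, ← Ring.multichoose_eq, mul_comm] using h

theorem hypergeometric_eq_tsum (α β x : ℝ) :
    ₂F₁ α β (1 : ℝ) x = ∑' n : ℕ, multichoose α n * multichoose β n * x ^ n := by
  rw [ordinaryHypergeometric_eq_tsum]
  refine tsum_congr fun n => ?_
  rw [← factorial_mul_multichoose, ← factorial_mul_multichoose, ascPochhammer_eval_one, smul_eq_mul]
  field_simp

/-- Only an inequality: the series is a polynomial, of infinite radius, when `α` or `β` is a
nonpositive integer, and has radius exactly `1` otherwise. -/
theorem one_le_radius_hypergeometric (α β : ℝ) :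
    1 ≤ (ordinaryHypergeometricSeries ℝ α β (1 : ℝ)).radius := by
  by_cases hα : ∃ k : ℕ, (k : ℝ) = -α
  · obtain ⟨k, hk⟩ := hα
    rw [← neg_neg α, ← hk, ordinaryHypergeometric_radius_top_of_neg_nat₁]
    exact le_top
  by_cases hβ : ∃ k : ℕ, (k : ℝ) = -β
  · obtain ⟨k, hk⟩ := hβ
    rw [← neg_neg β, ← hk, ordinaryHypergeometric_radius_top_of_neg_nat₂]
    exact le_top
  push Not at hα hβ
  refine (ordinaryHypergeometricSeries_radius_eq_one ℝ α β 1 fun k => ⟨hα k, hβ k, ?_⟩).ge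
  have : (0 : ℝ) ≤ k := k.cast_nonneg
  linarith

theorem summable_norm_hypergeometric (α β : ℝ) {x : ℝ} (hx : |x| < 1) :
    Summable fun n : ℕ => ‖multichoose α n * multichoose β n * x ^ n‖ := by
  have h := (ordinaryHypergeometricSeries ℝ α β (1 : ℝ)).summable_norm_apply (x := x)
    (Metric.eball_subset_eball (one_le_radius_hypergeometric α β)
      (by simpa [← ofReal_norm] using hx))
  refine h.congr fun n => ?_
  rw [ordinaryHypergeometricSeries_apply_eq, ← factorial_mul_multichoose,
    ← factorial_mul_multichoose, ascPochhammer_eval_one, smul_eq_mul]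
  congr 1
  field_simp

theorem hasSum_hypergeometric (α β : ℝ) {x : ℝ} (hx : |x| < 1) :
    HasSum (fun n : ℕ => multichoose α n * multichoose β n * x ^ n) (₂F₁ α β (1 : ℝ) x) := by
  rw [hypergeometric_eq_tsum]
  exact (summable_norm_hypergeometric α β hx).of_norm.hasSum

theorem analyticOnNhd_hypergeometric (α β : ℝ) :
    AnalyticOnNhd ℝ (fun x : ℝ => ₂F₁ α β (1 : ℝ) x) (Ioo (-1) 1) := by
  have h := (ordinaryHypergeometricSeries ℝ α β (1 : ℝ)).hasFPowerSeriesOnBall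
    (zero_lt_one.trans_le (one_le_radius_hypergeometric α β))
  intro x hx
  refine h.analyticOnNhd x (Metric.eball_subset_eball (one_le_radius_hypergeometric α β) ?_)
  have : |x| < 1 := abs_lt.2 hx
  simpa [← ofReal_norm] using this

/-! ### Pfaff's and Euler's transformations -/

/-- Pfaff's transformation close to the origin. -/
theorem hypergeometric_pfaff (α β : ℝ) {x : ℝ} (hx : |x| < 1 / 2) :
    ₂F₁ α β (1 : ℝ) x = (1 - x) ^ (-β) * ₂F₁ β (1 - α) (1 : ℝ) (-x / (1 - x)) := by
  have hx1 : |x| < 1 := by linarith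
  have hxx := abs_lt.1 hx
  have hpos : 0 < 1 - x := by linarith
  have hpos' : 0 < 1 - |x| := by linarith
  -- `T` arises on the right-hand side by expanding each `(1 - x)^(-β-k)` binomially. Row sums give
  -- back that side; diagonal sums give the left-hand side by Chu–Vandermonde. `B` majorises `T`,
  -- and its row sums form a hypergeometric series at `|x| / (1 - |x|)`, which is below `1` because
  -- `|x| < 1/2`.
  let T : ℕ × ℕ → ℝ := fun p => multichoose β p.1 * multichoose (β + p.1) p.2 *
    ((-1) ^ p.1 * multichoose (1 - α) p.1) * x ^ (p.1 + p.2)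
  let B : ℕ × ℕ → ℝ := fun p => (multichoose |β| p.1 * multichoose |1 - α| p.1 * |x| ^ p.1) *
    (multichoose (|β| + p.1) p.2 * |x| ^ p.2)
  have hB0 : 0 ≤ B := fun p => by
    have := multichoose_nonneg (abs_nonneg β) p.1
    have := multichoose_nonneg (abs_nonneg (1 - α)) p.1
    have := multichoose_nonneg (by positivity : 0 ≤ |β| + p.1) p.2
    simp only [Pi.zero_apply, B]
    positivity
  have hBrow (k : ℕ) : HasSum (fun j => B (k, j))
      ((multichoose |β| k * multichoose |1 - α| k * |x| ^ k) * (1 - |x|) ^ (-(|β| + k))) :=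
    (hasSum_multichoose (|β| + k) (by rwa [abs_abs])).mul_left _
  have hB : Summable B := by
    refine (summable_prod_of_nonneg hB0).2 ⟨fun k => (hBrow k).summable, ?_⟩
    have hq : |(|x| / (1 - |x|))| < 1 := by
      rw [abs_of_nonneg (by positivity), div_lt_one hpos']
      linarith
    refine ((summable_norm_hypergeometric |β| |1 - α| hq).of_norm.mul_left
      ((1 - |x|) ^ (-|β|))).congr fun k => ?_
    rw [(hBrow k).tsum_eq, neg_add, Real.rpow_add hpos', Real.rpow_neg hpos'.le (k : ℝ),
      Real.rpow_natCast, div_pow]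
    field_simp
  have hT : Summable T := by
    refine Summable.of_norm_bounded hB fun p => ?_
    have h1 := abs_multichoose_le (le_refl |β|) p.1
    have h2 := abs_multichoose_le (le_refl |1 - α|) p.1
    have h3 : |multichoose (β + p.1) p.2| ≤ multichoose (|β| + p.1) p.2 :=
      abs_multichoose_le ((abs_add_le _ _).trans (by simp)) p.2
    have := (abs_nonneg _).trans h1
    have := (abs_nonneg _).trans h2
    have := (abs_nonneg _).trans h3
    calc ‖T p‖ = |multichoose β p.1| * |multichoose (1 - α) p.1| * |x| ^ p.1 *
          (|multichoose (β + p.1) p.2| * |x| ^ p.2) := by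
            simp only [T, norm_mul, norm_pow, norm_neg, norm_one, one_pow, one_mul,
              Real.norm_eq_abs, pow_add]
            ring
      _ ≤ B p := by simp only [B]; gcongr
  have hsum1 : ∑' p, T p = (1 - x) ^ (-β) * ₂F₁ β (1 - α) (1 : ℝ) (-x / (1 - x)) := by
    rw [hT.tsum_prod, hypergeometric_eq_tsum, ← tsum_mul_left]
    refine tsum_congr fun k => ?_
    have h := (hasSum_multichoose (β + k) hx1).mul_left
      (multichoose β k * multichoose (1 - α) k * (-x) ^ k)
    rw [neg_add, Real.rpow_add hpos, Real.rpow_neg hpos.le (k : ℝ), Real.rpow_natCast] at h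
    have h' : ∀ j, T (k, j) = multichoose β k * multichoose (1 - α) k * (-x) ^ k *
        (multichoose (β + k) j * x ^ j) := fun j => by
      simp only [T, pow_add, neg_pow x]; ring
    simp only [h']
    rw [h.tsum_eq, div_pow]
    field_simp
  have hsum2 : ∑' p, T p = ₂F₁ α β (1 : ℝ) x := by
    let e := Finset.HasAntidiagonal.sigmaAntidiagonalEquivProd (A := ℕ)
    have hs : ∑' c, T (e c) = ∑' n, ∑' p : Finset.HasAntidiagonal.antidiagonal n, T (e ⟨n, p⟩) :=
      Summable.tsum_sigma (e.summable_iff.2 hT)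
    rw [hypergeometric_eq_tsum, ← e.tsum_eq T, hs]
    refine tsum_congr fun n => ?_
    rw [tsum_fintype, ← sum_antidiagonal_choose_mul_multichoose α n, Finset.sum_mul, Finset.sum_mul]
    refine (Finset.sum_congr rfl fun p _ => ?_).trans (Finset.sum_coe_sort
      (Finset.HasAntidiagonal.antidiagonal n) fun p : ℕ × ℕ => ((p.1 + p.2).choose p.1 : ℝ) *
        ((-1) ^ p.1 * multichoose (1 - α) p.1) * multichoose β n * x ^ n)
    have hp : p.1.1 + p.1.2 = n := Finset.HasAntidiagonal.mem_antidiagonal.1 p.2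
    simp only [T, e, Finset.HasAntidiagonal.sigmaAntidiagonalEquivProd_apply, multichoose_mul_multichoose_add, hp]
    ring
  rw [← hsum2, hsum1]

theorem analyticAt_rpow_const {x : ℝ} (hx : 0 < x) (p : ℝ) :
    AnalyticAt ℝ (fun y : ℝ => y ^ p) x := by
  refine (((analyticAt_id.log hx).mul analyticAt_const).rexp).congr (f := fun y => Real.exp (Real.log y * p)) ?_
  filter_upwards [lt_mem_nhds hx] with y hy
  rw [Real.rpow_def_of_pos hy]

/-- Euler's transformation. -/
theorem hypergeometric_euler (α β : ℝ) {x : ℝ} (hx : x ∈ Ioo (-1 : ℝ) 1) :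
    ₂F₁ α β (1 : ℝ) x = (1 - x) ^ (1 - α - β) * ₂F₁ (1 - α) (1 - β) (1 : ℝ) x := by
  have hanal : AnalyticOnNhd ℝ
      (fun x : ℝ => (1 - x) ^ (1 - α - β) * ₂F₁ (1 - α) (1 - β) (1 : ℝ) x) (Ioo (-1) 1) := by
    refine AnalyticOnNhd.mul ?_ (analyticOnNhd_hypergeometric _ _)
    intro y hy
    have : 0 < 1 - y := by linarith [hy.2]
    exact (analyticAt_rpow_const this (1 - α - β)).comp (analyticAt_const.sub analyticAt_id)
  refine (analyticOnNhd_hypergeometric α β).eqOn_of_preconnected_of_eventuallyEq hanal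
    isPreconnected_Ioo (z₀ := 0) (by norm_num) ?_ hx
  -- Near `0` Euler's transformation is Pfaff's applied twice, `y ↦ -y / (1 - y)` being an
  -- involution. The bound `|y| < 1/3` puts the image within the radius `1/2` required for the
  -- second application.
  have : Ioo (-(1 / 3) : ℝ) (1 / 3) ∈ 𝓝 (0 : ℝ) := Ioo_mem_nhds (by norm_num) (by norm_num)
  filter_upwards [this] with y hy
  have hy' : |y| < 1 / 3 := abs_lt.2 hy
  have h1 : 0 < 1 - y := by linarith [hy.2]
  have h2 : |(-y / (1 - y))| < 1 / 2 := by
    rw [abs_div, abs_neg, abs_of_pos h1, div_lt_iff₀ h1]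
    linarith [(abs_lt.1 hy').2]
  have h3 : 1 - -y / (1 - y) = (1 - y)⁻¹ := by field_simp; ring
  rw [hypergeometric_pfaff α β (by linarith), hypergeometric_pfaff β (1 - α) h2, h3,
    Real.inv_rpow h1.le, neg_sub, ← Real.rpow_neg h1.le, ← mul_assoc, ← Real.rpow_add h1]
  congr 2
  · ring
  · field_simp

/-! ### Averages over the angle of rotation -/

theorem two_pi_inv_mul : ENNReal.ofReal (2 * Real.pi)⁻¹ * ENNReal.ofReal (2 * Real.pi) = 1 := by
  rw [← ENNReal.ofReal_mul (by positivity), inv_mul_cancel₀ (by positivity), ENNReal.ofReal_one]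

/-- The uniform probability measure on `[0, 2π)`. -/
noncomputable def angle : Measure ℝ :=
  ENNReal.ofReal (2 * Real.pi)⁻¹ • volume.restrict (Ico 0 (2 * Real.pi))

theorem lintegral_angle (f : ℝ → ℝ≥0∞) :
    ∫⁻ φ, f φ ∂angle = ENNReal.ofReal (2 * Real.pi)⁻¹ * ∫⁻ φ in Ico 0 (2 * Real.pi), f φ := by
  rw [angle, lintegral_smul_measure, smul_eq_mul]

theorem integral_angle {E : Type*} [NormedAddCommGroup E] [NormedSpace ℝ E] (f : ℝ → E) :
    ∫ φ, f φ ∂angle = (2 * Real.pi)⁻¹ • ∫ φ in (0)..(2 * Real.pi), f φ := by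
  rw [angle, integral_smul_measure, intervalIntegral.integral_of_le Real.two_pi_pos.le,
    integral_Ico_eq_integral_Ioc, ENNReal.toReal_ofReal (by positivity)]

instance : IsProbabilityMeasure angle := by
  refine ⟨?_⟩
  rw [angle, Measure.smul_apply, Measure.restrict_apply_univ, Real.volume_Ico, sub_zero, smul_eq_mul,
    two_pi_inv_mul]

theorem lintegral_angle_add (c : ℝ) {f : ℝ → ℝ≥0∞} (hf : Function.Periodic f (2 * Real.pi)) :
    ∫⁻ φ, f (φ + c) ∂angle = ∫⁻ φ, f φ ∂angle := by
  have h1 : ∫⁻ φ in Ioc 0 (2 * Real.pi), f (φ + c) = ∫⁻ φ in Ioc c (c + 2 * Real.pi), f φ := by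
    rw [← (measurePreserving_add_right volume c).setLIntegral_comp_preimage_emb
      (measurableEmbedding_addRight c) f]
    simp
  have h2 : ∫⁻ φ in Ioc c (c + 2 * Real.pi), f φ = ∫⁻ φ in Ioc 0 (0 + 2 * Real.pi), f φ := by
    refine (isAddFundamentalDomain_Ioc Real.two_pi_pos c volume).setLIntegral_eq
      (isAddFundamentalDomain_Ioc Real.two_pi_pos 0 volume) f fun g x => ?_
    obtain ⟨n, hn⟩ := AddSubgroup.mem_zmultiples_iff.1 g.2
    rw [AddSubgroup.vadd_def, ← hn, vadd_eq_add, add_comm]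
    exact hf.zsmul n x
  rw [lintegral_angle, lintegral_angle, setLIntegral_congr Ico_ae_eq_Ioc,
    setLIntegral_congr (Ico_ae_eq_Ioc (a := (0 : ℝ))), h1, h2, zero_add]

theorem ae_angle_of_mem {p : ℝ → Prop} (h : ∀ φ ∈ Ioo 0 (2 * Real.pi), p φ) : ∀ᵐ φ ∂angle, p φ := by
  have : ∀ᵐ φ ∂volume.restrict (Ico 0 (2 * Real.pi)), p φ := by
    rw [Measure.restrict_congr_set Ioo_ae_eq_Ico.symm]
    exact (ae_restrict_iff' measurableSet_Ioo).2 (ae_of_all _ h)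
  exact Measure.ae_smul_measure this _

theorem integrable_angle_of_continuous {E : Type*} [NormedAddCommGroup E] {f : ℝ → E}
    (hf : Continuous f) : Integrable f angle :=
  (hf.integrableOn_Icc.mono_set Ico_subset_Icc_self).smul_measure ENNReal.ofReal_ne_top

/-- The only zero in `[0, 2π)` is `φ = π`. Off this null set `sin² (φ/2) < 1`, so binomial series in
`k sin² (φ/2)` converge even for `k = 1`. -/
theorem ae_angle_cos_ne_zero : ∀ᵐ φ ∂angle, Real.cos (φ / 2) ≠ 0 := by
  have hnull : ∀ᵐ φ ∂(volume.restrict (Ico 0 (2 * Real.pi))), φ ≠ Real.pi :=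
    ae_restrict_of_ae (Measure.ae_ne volume Real.pi)
  have h : ∀ᵐ φ ∂angle, φ ≠ Real.pi := Measure.ae_smul_measure hnull _
  filter_upwards [h, ae_angle_of_mem fun φ hφ => hφ] with φ hφ hmem hcos
  have h1 : Real.sin (φ / 2 - Real.pi / 2) = 0 := by rw [Real.sin_sub_pi_div_two, hcos, neg_zero]
  have := Real.pi_pos
  rw [Real.sin_eq_zero_iff_of_lt_of_lt (by linarith [hmem.1]) (by linarith [hmem.2])] at h1
  exact hφ (by linarith)

/-! ### Moments of `sin² (φ / 2)` -/

/-- The substitution `x = sin² (φ / 2)`. -/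
theorem lintegral_angle_sin_sq (g : ℝ → ℝ≥0∞) :
    ∫⁻ φ, g (Real.sin (φ / 2) ^ 2) ∂angle = ENNReal.ofReal Real.pi⁻¹ *
      ∫⁻ x in Ioo 0 1, ENNReal.ofReal (x ^ (-(1 / 2) : ℝ) * (1 - x) ^ (-(1 / 2) : ℝ)) * g x := by
  have hpi := Real.pi_pos
  have himg : (fun φ => Real.sin (φ / 2) ^ 2) '' Ioo 0 Real.pi = Ioo 0 1 := by
    ext x
    constructor
    · rintro ⟨φ, hφ, rfl⟩
      have h1 : 0 < Real.sin (φ / 2) :=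
        Real.sin_pos_of_pos_of_lt_pi (by linarith [hφ.1]) (by linarith [hφ.2])
      have h2 : 0 < Real.cos (φ / 2) :=
        Real.cos_pos_of_mem_Ioo ⟨by linarith [hφ.1], by linarith [hφ.2]⟩
      exact ⟨by positivity, by nlinarith [Real.sin_sq_add_cos_sq (φ / 2)]⟩
    · rintro ⟨h0, h1⟩
      have hs0 : 0 < √x := Real.sqrt_pos.2 h0
      have hs1 : √x < 1 := by rw [Real.sqrt_lt' one_pos]; simpa using h1
      refine ⟨2 * Real.arcsin √x, ⟨by have := Real.arcsin_pos.2 hs0; linarith, ?_⟩, ?_⟩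
      · have := Real.arcsin_lt_pi_div_two.2 hs1
        linarith
      · simp only
        rw [mul_div_cancel_left₀ _ two_ne_zero, Real.sin_arcsin (by linarith) hs1.le,
          Real.sq_sqrt h0.le]
  have hinj : InjOn (fun φ => Real.sin (φ / 2) ^ 2) (Ioo 0 Real.pi) := by
    intro φ hφ ψ hψ h
    have h1 : 0 < Real.sin (φ / 2) :=
      Real.sin_pos_of_pos_of_lt_pi (by linarith [hφ.1]) (by linarith [hφ.2])
    have h2 : 0 < Real.sin (ψ / 2) :=
      Real.sin_pos_of_pos_of_lt_pi (by linarith [hψ.1]) (by linarith [hψ.2])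
    have h3 := (pow_left_inj₀ h1.le h2.le two_ne_zero).1 h
    have := Real.injOn_sin ⟨by linarith [hφ.1], by linarith [hφ.2]⟩
      ⟨by linarith [hψ.1], by linarith [hψ.2]⟩ h3
    linarith
  have hderiv : ∀ φ ∈ Ioo 0 Real.pi, HasDerivWithinAt (fun φ => Real.sin (φ / 2) ^ 2)
      (Real.sin (φ / 2) * Real.cos (φ / 2)) (Ioo 0 Real.pi) φ := by
    intro φ _
    have h := (((hasDerivAt_id φ).div_const 2).sin).pow 2
    refine (h.congr_deriv ?_).hasDerivWithinAt
    simp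
    ring
  have hsub := lintegral_image_eq_lintegral_abs_deriv_mul measurableSet_Ioo hderiv hinj
    (fun x => ENNReal.ofReal (x ^ (-(1 / 2) : ℝ) * (1 - x) ^ (-(1 / 2) : ℝ)) * g x)
  have hhalf : ∫⁻ φ in Ioo 0 Real.pi, g (Real.sin (φ / 2) ^ 2) =
      ∫⁻ x in Ioo 0 1, ENNReal.ofReal (x ^ (-(1 / 2) : ℝ) * (1 - x) ^ (-(1 / 2) : ℝ)) * g x := by
    rw [← himg, hsub]
    -- The Jacobian `sin (φ/2) cos (φ/2) = x^(1/2) (1 - x)^(1/2)` cancels the weight.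
    refine setLIntegral_congr_fun measurableSet_Ioo fun φ hφ => ?_
    have h1 : 0 < Real.sin (φ / 2) :=
      Real.sin_pos_of_pos_of_lt_pi (by linarith [hφ.1]) (by linarith [hφ.2])
    have h2 : 0 < Real.cos (φ / 2) :=
      Real.cos_pos_of_mem_Ioo ⟨by linarith [hφ.1], by linarith [hφ.2]⟩
    rw [← mul_assoc, ← ENNReal.ofReal_mul (abs_nonneg _), abs_of_pos (by positivity),
      ← Real.cos_sq', ← Real.rpow_natCast_mul h1.le, ← Real.rpow_natCast_mul h2.le]
    norm_num [Real.rpow_neg_one]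
    rw [show Real.sin (φ / 2) * Real.cos (φ / 2) * ((Real.sin (φ / 2))⁻¹ * (Real.cos (φ / 2))⁻¹) = 1
      by field_simp]
    simp
  have hrefl : ∫⁻ φ in Ioo Real.pi (2 * Real.pi), g (Real.sin (φ / 2) ^ 2) =
      ∫⁻ φ in Ioo 0 Real.pi, g (Real.sin (φ / 2) ^ 2) := by
    rw [← (Measure.measurePreserving_sub_left volume (2 * Real.pi)).setLIntegral_comp_preimage_emb
      (MeasurableEquiv.subLeft (2 * Real.pi)).measurableEmbedding]
    have : (fun x => 2 * Real.pi - x) ⁻¹' Ioo Real.pi (2 * Real.pi) = Ioo 0 Real.pi := by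
      ext x; simp only [mem_preimage, mem_Ioo]; constructor <;> rintro ⟨h1, h2⟩ <;>
        constructor <;> linarith
    rw [this]
    refine setLIntegral_congr_fun measurableSet_Ioo fun φ _ => ?_
    rw [show (2 * Real.pi - φ) / 2 = Real.pi - φ / 2 by ring, Real.sin_pi_sub]
  have hsplit : ∫⁻ φ in Ico 0 (2 * Real.pi), g (Real.sin (φ / 2) ^ 2) =
      2 * ∫⁻ φ in Ioo 0 Real.pi, g (Real.sin (φ / 2) ^ 2) := by
    rw [← Ico_union_Ico_eq_Ico hpi.le (by linarith : Real.pi ≤ 2 * Real.pi),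
      lintegral_union measurableSet_Ico (Ico_disjoint_Ico_same),
      setLIntegral_congr Ioo_ae_eq_Ico.symm, setLIntegral_congr (Ioo_ae_eq_Ico (a := Real.pi)).symm,
      hrefl, two_mul]
  rw [lintegral_angle, hsplit, hhalf, ← mul_assoc]
  congr 1
  rw [← ENNReal.ofReal_ofNat 2, ← ENNReal.ofReal_mul (by positivity)]
  congr 1
  field_simp

/-- This is the normalisation of the density of the Beta distribution, multiplied through by its
constant. -/
theorem lintegral_beta {u v : ℝ} (hu : 0 < u) (hv : 0 < v) :
    ∫⁻ x in Ioo (0 : ℝ) 1, ENNReal.ofReal (x ^ (u - 1) * (1 - x) ^ (v - 1)) =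
      ENNReal.ofReal (Real.Gamma u * Real.Gamma v / Real.Gamma (u + v)) := by
  change _ = ENNReal.ofReal (ProbabilityTheory.beta u v)
  have hβ := ProbabilityTheory.beta_pos hu hv
  have h := ProbabilityTheory.lintegral_betaPDF_eq_one hu hv
  simp only [ProbabilityTheory.lintegral_betaPDF, mul_assoc,
    ENNReal.ofReal_mul (one_div_pos.2 hβ).le] at h
  rw [lintegral_const_mul' _ _ ENNReal.ofReal_ne_top] at h
  rw [← mul_one (ENNReal.ofReal (ProbabilityTheory.beta u v)), ← h, ← mul_assoc,
    ← ENNReal.ofReal_mul hβ.le, mul_one_div_cancel hβ.ne', ENNReal.ofReal_one, one_mul]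

/-- The mean of a power of the sine (Wallis' integral for real exponents). -/
theorem lintegral_angle_sin_rpow {p : ℝ} (hp : -1 < p) :
    ∫⁻ φ, ENNReal.ofReal (Real.sin (φ / 2) ^ 2) ^ (p / 2) ∂angle =
      ENNReal.ofReal (Real.Gamma ((p + 1) / 2) / (√Real.pi * Real.Gamma (p / 2 + 1))) := by
  rw [lintegral_angle_sin_sq (fun x => ENNReal.ofReal x ^ (p / 2))]
  have h : ∫⁻ x in Ioo (0 : ℝ) 1,
      ENNReal.ofReal (x ^ (-(1 / 2) : ℝ) * (1 - x) ^ (-(1 / 2) : ℝ)) * ENNReal.ofReal x ^ (p / 2) =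
      ∫⁻ x in Ioo (0 : ℝ) 1, ENNReal.ofReal (x ^ ((p + 1) / 2 - 1) * (1 - x) ^ ((1 / 2 : ℝ) - 1)) := by
    refine setLIntegral_congr_fun measurableSet_Ioo fun x hx => ?_
    have h1 : 0 < 1 - x := by linarith [hx.2]
    have h2 := hx.1
    rw [ENNReal.ofReal_rpow_of_pos hx.1, ← ENNReal.ofReal_mul (by positivity)]
    congr 1
    rw [mul_right_comm, ← Real.rpow_add hx.1]
    congr 2 <;> ring
  rw [h, lintegral_beta (by linarith) (by norm_num), ← ENNReal.ofReal_mul (by positivity),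
    Real.Gamma_one_half_eq]
  congr 1
  rw [show (p + 1) / 2 + 1 / 2 = p / 2 + 1 by ring]
  have := Real.sq_sqrt Real.pi_pos.le
  field_simp
  rw [this, mul_comm]

/-- After the substitution the integrand is at least `x^((p-1)/2)`, whose exponent is at most `-1`,
hence not integrable at `0`. -/
theorem lintegral_angle_sin_rpow_eq_top {p : ℝ} (hp : p ≤ -1) :
    ∫⁻ φ, ENNReal.ofReal (Real.sin (φ / 2) ^ 2) ^ (p / 2) ∂angle = ⊤ := by
  rw [lintegral_angle_sin_sq (fun x => ENNReal.ofReal x ^ (p / 2))]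
  have h : ∫⁻ x in Ioo (0 : ℝ) 1, ENNReal.ofReal (x ^ ((p - 1) / 2)) = ⊤ := by
    by_contra hne
    have hint : IntegrableOn (fun x : ℝ => x ^ ((p - 1) / 2)) (Ioo 0 1) := by
      refine ⟨by fun_prop, (hasFiniteIntegral_iff_ofReal ?_).2 (lt_top_iff_ne_top.2 hne)⟩
      exact ae_restrict_of_forall_mem measurableSet_Ioo fun x hx => Real.rpow_nonneg hx.1.le _
    have := (intervalIntegral.integrableOn_Ioo_rpow_iff zero_lt_one).1 hint
    linarith
  rw [ENNReal.mul_eq_top]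
  refine Or.inl ⟨by simpa using Real.pi_pos, top_le_iff.1 (h.ge.trans ?_)⟩
  refine setLIntegral_mono' measurableSet_Ioo fun x hx => ?_
  have h1 : 0 < 1 - x := by linarith [hx.2]
  have h2 := hx.1
  rw [ENNReal.ofReal_rpow_of_pos hx.1, ← ENNReal.ofReal_mul (by positivity)]
  refine ENNReal.ofReal_le_ofReal ?_
  rw [mul_right_comm, ← Real.rpow_add hx.1, show -(1 / 2) + p / 2 = (p - 1) / 2 by ring]
  refine le_mul_of_one_le_right (by positivity) ?_
  exact Real.one_le_rpow_of_pos_of_le_one_of_nonpos h1 (by linarith) (by norm_num)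

theorem multichoose_half_eq (n : ℕ) :
    multichoose (1 / 2 : ℝ) n = Real.Gamma (n + 1 / 2) / (√Real.pi * Real.Gamma (n + 1)) := by
  have hpi := Real.sqrt_pos.2 Real.pi_pos
  induction n with
  | zero => simp [-one_div, Real.Gamma_one_half_eq, hpi.ne']
  | succ n ih =>
    have := Real.Gamma_pos_of_pos (by positivity : (0 : ℝ) < n + 1)
    rw [multichoose_succ, ih]
    push_cast
    rw [Real.Gamma_add_one (by positivity : (n : ℝ) + 1 ≠ 0), add_right_comm,
      Real.Gamma_add_one (by positivity : (n : ℝ) + 1 / 2 ≠ 0)]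
    field_simp
    ring

/-- These moments are the source of the parameter `1/2` in the hypergeometric representations: each
equals `(1/2)_n / n!`. -/
theorem integral_angle_sin_pow (n : ℕ) :
    ∫ φ, (Real.sin (φ / 2) ^ 2) ^ n ∂angle = multichoose (1 / 2 : ℝ) n := by
  have h := lintegral_angle_sin_rpow (p := 2 * n) (by linarith [n.cast_nonneg (α := ℝ)])
  rw [show (2 * n + 1 : ℝ) / 2 = n + 1 / 2 by ring, mul_div_cancel_left₀ _ two_ne_zero,
    ← multichoose_half_eq] at h
  rw [integral_eq_lintegral_of_nonneg_ae (ae_of_all _ fun φ => by positivity) (by fun_prop)]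
  simp only [ENNReal.rpow_natCast, ← ENNReal.ofReal_pow (sq_nonneg _)] at h
  rw [h, ENNReal.toReal_ofReal (multichoose_nonneg (by norm_num) n)]

/-! ### The kernel as a mean depending on two distances -/

/-- The mean of `(a² cos² (φ / 2) + b² sin² (φ / 2))^(-s/2)` over the angle `φ`. -/
noncomputable def mean (s a b : ℝ) : ℝ≥0∞ :=
  ∫⁻ φ, ENNReal.ofReal (a ^ 2 * Real.cos (φ / 2) ^ 2 + b ^ 2 * Real.sin (φ / 2) ^ 2) ^ (-(s / 2))
    ∂angle

/-- Rotation by `0` gives the distance to `w`, rotation by `π` the distance to its mirror image. The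
squared distance interpolates between these two squares. -/
theorem norm_rot_embed_sub_sq (φ : ℝ) (z w : ℂ) :
    ‖rot φ (embed z) - embed w‖ ^ 2 =
      ‖z - w‖ ^ 2 * Real.cos (φ / 2) ^ 2 + ‖z - reflect w‖ ^ 2 * Real.sin (φ / 2) ^ 2 := by
  have hc : Real.cos φ = Real.cos (φ / 2) ^ 2 - Real.sin (φ / 2) ^ 2 := by
    rw [← Real.cos_two_mul', mul_div_cancel₀ _ two_ne_zero]
  have hs : Real.sin φ = 2 * Real.sin (φ / 2) * Real.cos (φ / 2) := by
    rw [← Real.sin_two_mul, mul_div_cancel₀ _ two_ne_zero]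
  have h1 := Real.sin_sq_add_cos_sq (φ / 2)
  rw [EuclideanSpace.norm_sq_eq, Fin.sum_univ_three, Complex.sq_norm, Complex.sq_norm,
    Complex.normSq_apply, Complex.normSq_apply]
  simp only [rot, embed, reflect, Real.norm_eq_abs, sq_abs, PiLp.sub_apply, Complex.sub_re,
    Complex.sub_im, Complex.neg_re, Complex.neg_im, Complex.conj_re, Complex.conj_im]
  simp
  rw [hc, hs]
  generalize Real.cos (φ / 2) = c at *
  generalize Real.sin (φ / 2) = d at *
  have h2 : c ^ 2 = 1 - d ^ 2 := by linarith
  grind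

theorem extKernel_eq_mean (s : ℝ) (z w : ℂ) :
    extKernel s z w = mean s ‖z - w‖ ‖z - reflect w‖ := by
  rw [extKernel, ← lintegral_angle, mean]
  refine lintegral_congr fun φ => ?_
  rw [← norm_rot_embed_sub_sq, ENNReal.ofReal_pow (norm_nonneg _), ofReal_norm,
    ← ENNReal.rpow_natCast_mul]
  congr 1
  push_cast
  ring

theorem measurable_mean_integrand (s a b : ℝ) : Measurable fun φ : ℝ =>
    ENNReal.ofReal (a ^ 2 * Real.cos (φ / 2) ^ 2 + b ^ 2 * Real.sin (φ / 2) ^ 2) ^ (-(s / 2)) := by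
  fun_prop

/-- Shifting `φ` by `π` exchanges `cos² (φ/2)` and `sin² (φ/2)`. -/
theorem mean_comm (s a b : ℝ) : mean s a b = mean s b a := by
  have hper : Function.Periodic (fun φ : ℝ => ENNReal.ofReal (a ^ 2 * Real.cos (φ / 2) ^ 2 +
      b ^ 2 * Real.sin (φ / 2) ^ 2) ^ (-(s / 2))) (2 * Real.pi) := fun φ => by
    simp only [add_div, mul_div_cancel_left₀ _ (two_ne_zero' ℝ), Real.cos_add_pi, Real.sin_add_pi,
      neg_sq]
  rw [mean, ← lintegral_angle_add Real.pi hper, mean]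
  refine lintegral_congr fun φ => ?_
  rw [add_div, Real.cos_add_pi_div_two, Real.sin_add_pi_div_two, neg_sq, add_comm]

theorem mean_mul (s a b : ℝ) {r : ℝ} (hr : 0 < r) :
    mean s (r * a) (r * b) = ENNReal.ofReal (r ^ (-s)) * mean s a b := by
  rw [mean, mean, ← lintegral_const_mul' _ _ ENNReal.ofReal_ne_top]
  refine lintegral_congr fun φ => ?_
  rw [show (r * a) ^ 2 * Real.cos (φ / 2) ^ 2 + (r * b) ^ 2 * Real.sin (φ / 2) ^ 2 =
      r ^ 2 * (a ^ 2 * Real.cos (φ / 2) ^ 2 + b ^ 2 * Real.sin (φ / 2) ^ 2) by ring,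
    ENNReal.ofReal_mul (by positivity), ENNReal.mul_rpow_of_ne_top ENNReal.ofReal_ne_top
      ENNReal.ofReal_ne_top, ENNReal.ofReal_rpow_of_pos (by positivity),
    ← Real.rpow_natCast_mul hr.le]
  congr 3
  push_cast
  ring

theorem mean_zero_left {s b : ℝ} (hb : 0 < b) :
    mean s 0 b = ENNReal.ofReal (b ^ (-s)) *
      ∫⁻ φ, ENNReal.ofReal (Real.sin (φ / 2) ^ 2) ^ (-s / 2) ∂angle := by
  have h := mean_mul s 0 1 hb
  rw [mul_zero, mul_one] at h
  rw [h, mean]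
  simp [neg_div]

theorem mean_zero_left_of_lt_one {s b : ℝ} (hs : s < 1) (hb : 0 < b) :
    mean s 0 b = ENNReal.ofReal (b ^ (-s) *
      (Real.Gamma ((1 - s) / 2) / (√Real.pi * Real.Gamma (1 - s / 2)))) := by
  rw [mean_zero_left hb, lintegral_angle_sin_rpow (by linarith), ← ENNReal.ofReal_mul (by positivity),
    show -s + 1 = 1 - s by ring, show -s / 2 + 1 = 1 - s / 2 by ring]

theorem mean_zero_left_eq_top {s b : ℝ} (hs : 1 ≤ s) (hb : 0 ≤ b) : mean s 0 b = ⊤ := by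
  rcases hb.eq_or_lt with rfl | hb
  -- For `b = 0` the integrand is zero to a negative power, that is `⊤`, at every angle.
  · have : -(s / 2) < 0 := by linarith
    simp [mean, ENNReal.zero_rpow_of_neg this]
  · rw [mean_zero_left hb, lintegral_angle_sin_rpow_eq_top (by linarith), ENNReal.mul_top]
    simpa using by positivity

theorem quadratic_pos {a b : ℝ} (ha : 0 < a) (hb : 0 < b) (φ : ℝ) :
    0 < a ^ 2 * Real.cos (φ / 2) ^ 2 + b ^ 2 * Real.sin (φ / 2) ^ 2 := by
  rcases eq_or_ne (Real.cos (φ / 2)) 0 with h | h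
  · have := Real.sin_sq_add_cos_sq (φ / 2)
    rw [h] at this ⊢
    have h2 : Real.sin (φ / 2) ^ 2 = 1 := by linarith
    rw [h2]
    positivity
  · positivity

theorem continuous_quadratic_rpow {a b : ℝ} (ha : 0 < a) (hb : 0 < b) (p : ℝ) :
    Continuous fun φ =>
      (a ^ 2 * Real.cos (φ / 2) ^ 2 + b ^ 2 * Real.sin (φ / 2) ^ 2) ^ p :=
  (by fun_prop : Continuous fun φ =>
    a ^ 2 * Real.cos (φ / 2) ^ 2 + b ^ 2 * Real.sin (φ / 2) ^ 2).rpow_const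
      fun φ => Or.inl (quadratic_pos ha hb φ).ne'

/-! ### Hypergeometric expansions of the mean -/

theorem mean_eq_ofReal_integral {s a b : ℝ} (ha : 0 < a) (hb : 0 < b) :
    mean s a b = ENNReal.ofReal (∫ φ, (a ^ 2 * Real.cos (φ / 2) ^ 2 + b ^ 2 * Real.sin (φ / 2) ^ 2)
      ^ (-(s / 2)) ∂angle) := by
  rw [ofReal_integral_eq_lintegral_ofReal
    (integrable_angle_of_continuous (continuous_quadratic_rpow ha hb _))
    (ae_of_all _ fun φ => Real.rpow_nonneg (quadratic_pos ha hb φ).le _)]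
  exact lintegral_congr fun φ => ENNReal.ofReal_rpow_of_pos (quadratic_pos ha hb φ)

/-- For positive exponents the expansion includes the singular case `k = 1`, with values in
`[0, ∞]`. -/
theorem lintegral_one_sub_mul_sin_sq {σ k : ℝ} (hσ : 0 < σ) (hk0 : 0 ≤ k) (hk1 : k ≤ 1) :
    ∫⁻ φ, ENNReal.ofReal (1 - k * Real.sin (φ / 2) ^ 2) ^ (-σ) ∂angle =
      ∑' n : ℕ, ENNReal.ofReal (multichoose σ n * multichoose (1 / 2 : ℝ) n * k ^ n) := by
  have hae : ∀ᵐ φ ∂angle, ENNReal.ofReal (1 - k * Real.sin (φ / 2) ^ 2) ^ (-σ) =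
      ∑' n : ℕ, ENNReal.ofReal (multichoose σ n * (k * Real.sin (φ / 2) ^ 2) ^ n) := by
    filter_upwards [ae_angle_cos_ne_zero] with φ hφ
    have h1 := Real.sin_sq_add_cos_sq (φ / 2)
    have h2 : 0 < Real.cos (φ / 2) ^ 2 := sq_pos_of_ne_zero hφ
    have h3 : 0 ≤ k * Real.sin (φ / 2) ^ 2 := by positivity
    have h4 : k * Real.sin (φ / 2) ^ 2 < 1 := by nlinarith [sq_nonneg (Real.sin (φ / 2))]
    have h := hasSum_multichoose σ (abs_lt.2 ⟨by linarith, h4⟩)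
    rw [ENNReal.ofReal_rpow_of_pos (by linarith), ← h.tsum_eq,
      ENNReal.ofReal_tsum_of_nonneg (fun n => ?_) h.summable]
    have := multichoose_nonneg hσ.le n
    positivity
  rw [lintegral_congr_ae hae, lintegral_tsum fun n => by fun_prop]
  refine tsum_congr fun n => ?_
  have h0 := multichoose_nonneg hσ.le n
  rw [← ofReal_integral_eq_lintegral_ofReal]
  · congr 1
    simp only [mul_pow]
    rw [integral_const_mul, integral_const_mul, integral_angle_sin_pow]
    ring
  · refine Integrable.of_bound (by fun_prop) (multichoose σ n * k ^ n) (ae_of_all _ fun φ => ?_)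
    rw [Real.norm_of_nonneg (by positivity), mul_pow]
    have : (Real.sin (φ / 2) ^ 2) ^ n ≤ 1 := pow_le_one₀ (sq_nonneg _) (Real.sin_sq_le_one _)
    gcongr
    exact mul_le_of_le_one_right (by positivity) this
  · exact ae_of_all _ fun φ => by simp only [Pi.zero_apply]; positivity

/-- Take out `b²` after exchanging `a` and `b`, and integrate the binomial series termwise. The case
`a = 0`, `s ≥ 1` is included by default values: `ENNReal.toReal ⊤` and the real sum of a divergent
series are both `0`. -/
theorem toReal_mean_eq {s a b : ℝ} (hs : 0 < s) (ha : 0 ≤ a) (hab : a ≤ b) (hb : 0 < b) :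
    (mean s a b).toReal = b ^ (-s) * ₂F₁ (s / 2) (1 / 2) (1 : ℝ) (1 - a ^ 2 / b ^ 2) := by
  have hq : a ^ 2 / b ^ 2 ≤ 1 := (div_le_one (by positivity)).2 (by gcongr)
  have hq0 : 0 ≤ a ^ 2 / b ^ 2 := by positivity
  have h := mean_mul s 1 (a / b) hb
  rw [mul_one, mul_div_cancel₀ _ hb.ne'] at h
  rw [mean_comm, h, ENNReal.toReal_mul, ENNReal.toReal_ofReal (by positivity)]
  congr 1
  have h2 : mean s 1 (a / b) = ∫⁻ φ, ENNReal.ofReal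
      (1 - (1 - a ^ 2 / b ^ 2) * Real.sin (φ / 2) ^ 2) ^ (-(s / 2)) ∂angle := by
    refine lintegral_congr fun φ => ?_
    rw [Real.cos_sq', div_pow]
    congr 2
    ring
  rw [h2, lintegral_one_sub_mul_sin_sq (by linarith) (by linarith) (by linarith),
    ENNReal.tsum_toReal_eq fun n => ENNReal.ofReal_ne_top, hypergeometric_eq_tsum]
  refine tsum_congr fun n => ENNReal.toReal_ofReal ?_
  have := multichoose_nonneg (by linarith : 0 ≤ s / 2) n
  have := multichoose_nonneg (by norm_num : (0 : ℝ) ≤ 1 / 2) n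
  have : 0 ≤ 1 - a ^ 2 / b ^ 2 := by linarith
  positivity

/-- Here `α` may be negative, so the terms have no fixed sign; `|k| < 1` supplies the absolute
convergence that positivity gave before. -/
theorem integral_one_sub_mul_sin_sq (α : ℝ) {k : ℝ} (hk : |k| < 1) :
    ∫ φ, (1 - k * Real.sin (φ / 2) ^ 2) ^ (-α) ∂angle = ₂F₁ α (1 / 2) (1 : ℝ) k := by
  have hbd (φ : ℝ) : (Real.sin (φ / 2) ^ 2) ≤ 1 := Real.sin_sq_le_one _
  have hser (φ : ℝ) : HasSum (fun n => multichoose α n * (k * Real.sin (φ / 2) ^ 2) ^ n)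
      ((1 - k * Real.sin (φ / 2) ^ 2) ^ (-α)) := by
    refine hasSum_multichoose α ?_
    rw [abs_mul, abs_of_nonneg (sq_nonneg (Real.sin _))]
    nlinarith [hbd φ, abs_nonneg k, sq_nonneg (Real.sin (φ / 2))]
  have hbd' (n : ℕ) (φ : ℝ) :
      ‖multichoose α n * (k * Real.sin (φ / 2) ^ 2) ^ n‖ ≤ ‖multichoose α n * k ^ n‖ := by
    rw [mul_pow, norm_mul, norm_mul, norm_mul, Real.norm_of_nonneg (by positivity : 0 ≤ (Real.sin (φ / 2) ^ 2) ^ n)]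
    gcongr
    exact mul_le_of_le_one_right (by positivity) (pow_le_one₀ (sq_nonneg _) (hbd φ))
  have hint (n : ℕ) : Integrable (fun φ => multichoose α n * (k * Real.sin (φ / 2) ^ 2) ^ n) angle :=
    Integrable.of_bound (by fun_prop) _ (ae_of_all _ (hbd' n))
  have hsum : Summable fun n => ∫ φ, ‖multichoose α n * (k * Real.sin (φ / 2) ^ 2) ^ n‖ ∂angle := by
    refine Summable.of_nonneg_of_le (fun n => integral_nonneg fun φ => norm_nonneg _) (fun n => ?_)
      (f := fun n => ‖multichoose α n * k ^ n‖) ?_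
    · calc _ ≤ ∫ _, ‖multichoose α n * k ^ n‖ ∂angle :=
            integral_mono (hint n).norm (integrable_const _) (hbd' n)
        _ = _ := by simp
    -- The binomial series is the hypergeometric one with `β = 1`, since `multichoose 1 n = 1`.
    · refine (summable_norm_hypergeometric α 1 hk).congr fun n => ?_
      rw [multichoose_eq_div 1 n, ascPochhammer_eval_one, div_self (by positivity), mul_one]
  have h := hasSum_integral_of_summable_integral_norm hint hsum
  rw [integral_congr_ae (ae_of_all _ fun φ => ((hser φ).tsum_eq).symm), ← h.tsum_eq,
    hypergeometric_eq_tsum]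
  refine tsum_congr fun n => ?_
  simp only [mul_pow]
  rw [integral_const_mul, integral_const_mul, integral_angle_sin_pow]
  ring

theorem integral_angle_exp (n : ℤ) :
    ∫ φ : ℝ, Complex.exp (n * Complex.I * φ) ∂angle = if n = 0 then 1 else 0 := by
  split_ifs with hn
  · simp [hn]
  · have h : (n : ℂ) * Complex.I ≠ 0 := by simp [hn]
    rw [integral_angle, integral_exp_mul_complex h]
    have : Complex.exp (n * Complex.I * ((2 * Real.pi : ℝ) : ℂ)) = 1 := by
      rw [Complex.exp_eq_one_iff]
      exact ⟨n, by push_cast; ring⟩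
    rw [this]
    simp

/-- Parseval's identity for the binomial series on the circle of radius `m < 1`. -/
theorem integral_norm_one_sub_mul_exp (σ : ℝ) {m : ℝ} (hm0 : 0 ≤ m) (hm1 : m < 1) :
    ∫ φ : ℝ, (‖1 - m * Complex.exp (Complex.I * φ)‖ ^ 2) ^ (-σ) ∂angle =
      ₂F₁ σ σ (1 : ℝ) (m ^ 2) := by
  have hz (φ : ℝ) : ‖(m : ℂ) * Complex.exp (Complex.I * φ)‖ = m := by
    rw [norm_mul, mul_comm Complex.I, Complex.norm_exp_ofReal_mul_I, mul_one, Complex.norm_real,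
      Real.norm_of_nonneg hm0]
  let t : ℕ → ℝ → ℂ := fun n φ => ((multichoose σ n : ℝ) : ℂ) * (m * Complex.exp (Complex.I * φ)) ^ n
  have hsum (φ : ℝ) : HasSum (fun n => t n φ) ((1 - m * Complex.exp (Complex.I * φ)) ^ (-σ : ℂ)) :=
    hasSum_multichoose_complex σ (by rwa [hz])
  have htn (n : ℕ) (φ : ℝ) : ‖t n φ‖ = ‖multichoose σ n * m ^ n‖ := by
    simp only [t, norm_mul, norm_pow, hz, Complex.norm_real, Real.norm_of_nonneg hm0]
  have hb : Summable fun n => ‖multichoose σ n * m ^ n‖ := by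
    refine (summable_norm_hypergeometric σ 1 (abs_lt.2 ⟨by linarith, hm1⟩)).congr fun n => ?_
    rw [multichoose_eq_div 1 n, ascPochhammer_eval_one, div_self (by positivity), mul_one]
  -- The double series of `(1 - z)^(-σ)` times its conjugate, with `z = m e^{iφ}`. It is absolutely
  -- summable uniformly in `φ`, and averaging keeps only its diagonal.
  let T : ℕ × ℕ → ℝ → ℂ := fun p φ => t p.1 φ * (starRingEnd ℂ) (t p.2 φ)
  have hTn (p : ℕ × ℕ) (φ : ℝ) :
      ‖T p φ‖ = ‖multichoose σ p.1 * m ^ p.1‖ * ‖multichoose σ p.2 * m ^ p.2‖ := by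
    simp only [T, norm_mul, RCLike.norm_conj, htn]
  have hTs : Summable fun p : ℕ × ℕ =>
      ‖multichoose σ p.1 * m ^ p.1‖ * ‖multichoose σ p.2 * m ^ p.2‖ :=
    hb.mul_of_nonneg hb (fun _ => norm_nonneg _) fun _ => norm_nonneg _
  have hT (φ : ℝ) : ∑' p, T p φ =
      (((‖1 - m * Complex.exp (Complex.I * φ)‖ ^ 2) ^ (-σ) : ℝ) : ℂ) := by
    have hs1 : Summable fun p => T p φ := Summable.of_norm (by simpa only [hTn] using hTs)
    have h := (hsum φ).mul (Complex.hasSum_conj'.2 (hsum φ)) hs1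
    rw [show ∑' p, T p φ = _ from h.tsum_eq, Complex.mul_conj, Complex.normSq_eq_norm_sq, ← Complex.ofReal_neg,
      Complex.norm_cpow_real, ← Real.rpow_mul_natCast (norm_nonneg _), ← Real.rpow_natCast_mul (norm_nonneg _),
      mul_comm (-σ)]
  have hcont (p : ℕ × ℕ) : Continuous (T p) := by
    simp only [T, t]
    fun_prop
  have hint (p : ℕ × ℕ) : Integrable (T p) angle :=
    Integrable.of_bound (hcont p).aestronglyMeasurable _ (ae_of_all _ fun φ => (hTn p φ).le)
  have h := hasSum_integral_of_summable_integral_norm hint (by simpa [hTn] using hTs)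
  simp only [hT] at h
  rw [integral_complex_ofReal] at h
  have hval (p : ℕ × ℕ) : ∫ φ, T p φ ∂angle =
      if p.1 = p.2 then (((multichoose σ p.1 * m ^ p.1) * (multichoose σ p.2 * m ^ p.2) : ℝ) : ℂ) else 0 := by
    have hrw (φ : ℝ) : T p φ = (((multichoose σ p.1 * m ^ p.1) * (multichoose σ p.2 * m ^ p.2) : ℝ) : ℂ) *
        Complex.exp (((p.1 - p.2 : ℤ) : ℂ) * Complex.I * φ) := by
      simp only [T, t, map_mul, map_pow, Complex.conj_ofReal, map_natCast, mul_pow, ← Complex.exp_conj, ← Complex.exp_nat_mul,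
        Complex.conj_I]
      rw [show ((p.1 - p.2 : ℤ) : ℂ) * Complex.I * φ = p.1 * (Complex.I * φ) + p.2 * (-Complex.I * φ) by
        push_cast; ring, Complex.exp_add]
      push_cast
      ring
    simp only [hrw]
    rw [integral_const_mul, integral_angle_exp]
    simp only [sub_eq_zero, Nat.cast_inj, mul_ite, mul_one, mul_zero]
  simp only [hval] at h
  have hdiag : Function.Injective fun n : ℕ => (n, n) := fun i j hij => (Prod.ext_iff.1 hij).1
  rw [← hdiag.hasSum_iff] at h
  · simp only [Function.comp_def, if_true] at h
    rw [hypergeometric_eq_tsum, ← (Complex.hasSum_ofReal.1 h).tsum_eq]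
    exact tsum_congr fun n => by ring
  · rintro ⟨i, j⟩ hij
    exact if_neg fun hij' => hij ⟨i, Prod.ext rfl hij'⟩

/-- The quadratic form with `a = 1 - m`, `b = 1 + m` is `|1 - m e^{iφ}|²`, so Parseval's identity
evaluates the mean. -/
theorem mean_one_sub_one_add (s : ℝ) {m : ℝ} (hm0 : 0 ≤ m) (hm1 : m < 1) :
    mean s (1 - m) (1 + m) = ENNReal.ofReal (₂F₁ (s / 2) (s / 2) (1 : ℝ) (m ^ 2)) := by
  rw [mean_eq_ofReal_integral (by linarith) (by linarith), ← integral_norm_one_sub_mul_exp _ hm0 hm1]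
  congr 2
  ext φ
  congr 1
  have hc : Real.cos φ = Real.cos (φ / 2) ^ 2 - Real.sin (φ / 2) ^ 2 := by
    rw [← Real.cos_two_mul', mul_div_cancel₀ _ two_ne_zero]
  have h1 := Real.sin_sq_add_cos_sq (φ / 2)
  have h2 := Real.sin_sq_add_cos_sq φ
  rw [Complex.sq_norm, Complex.normSq_apply, mul_comm Complex.I]
  simp only [Complex.sub_re, Complex.sub_im, Complex.one_re, Complex.one_im, Complex.re_ofReal_mul,
    Complex.im_ofReal_mul, Complex.exp_ofReal_mul_I_re, Complex.exp_ofReal_mul_I_im]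
  grind

/-! ### Comparison of means and the boundary case `a = 0` -/

theorem ennreal_rpow_neg_le {x y : ℝ≥0∞} (h : x ≤ y) {σ : ℝ} (hσ : 0 ≤ σ) :
    y ^ (-σ) ≤ x ^ (-σ) := by
  rw [ENNReal.rpow_neg, ENNReal.rpow_neg, ENNReal.inv_le_inv]
  exact ENNReal.rpow_le_rpow h hσ

theorem ennreal_rpow_neg_lt {x y : ℝ≥0∞} (h : x < y) {σ : ℝ} (hσ : 0 < σ) :
    y ^ (-σ) < x ^ (-σ) := by
  rw [ENNReal.rpow_neg, ENNReal.rpow_neg, ENNReal.inv_lt_inv]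
  exact ENNReal.rpow_lt_rpow h hσ

theorem mean_lt_top {s a b : ℝ} (ha : 0 < a) (hb : 0 < b) : mean s a b < ⊤ := by
  rw [mean_eq_ofReal_integral ha hb]
  exact ENNReal.ofReal_lt_top

/-- When both distances grow, the quadratic form grows at every angle. Strictness of the integrals
needs only the smaller mean to be finite, so `a = 0` is allowed. -/
theorem mean_lt_mean {s a b a' b' : ℝ} (hs : 0 < s) (ha : 0 ≤ a) (hb : 0 ≤ b) (haa : a < a')
    (hbb : b < b') : mean s a' b' < mean s a b := by
  refine lintegral_strict_mono (IsProbabilityMeasure.ne_zero angle)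
    (measurable_mean_integrand s a b).aemeasurable
    (mean_lt_top (ha.trans_lt haa) (hb.trans_lt hbb)).ne (ae_of_all _ fun φ => ?_)
  refine ennreal_rpow_neg_lt ((ENNReal.ofReal_lt_ofReal_iff
    (quadratic_pos (ha.trans_lt haa) (hb.trans_lt hbb) φ)).2 ?_) (by linarith)
  have h1 := quadratic_pos (a := a' ^ 2 - a ^ 2) (b := b' ^ 2 - b ^ 2) (by nlinarith) (by nlinarith) φ
  have h2 : 0 < a' ^ 2 - a ^ 2 := by nlinarith
  have h3 : 0 < b' ^ 2 - b ^ 2 := by nlinarith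
  have h4 := Real.sin_sq_add_cos_sq (φ / 2)
  rcases eq_or_ne (Real.cos (φ / 2)) 0 with h | h
  · rw [h] at h4 ⊢
    nlinarith
  · have h5 : 0 < Real.cos (φ / 2) ^ 2 := sq_pos_of_ne_zero h
    nlinarith [mul_pos h2 h5, mul_nonneg h3.le (sq_nonneg (Real.sin (φ / 2)))]

/-- The bound is uniform in `m`: the quadratic form never falls below `sin² (φ/2)`. -/
theorem mean_one_sub_one_add_le {s m : ℝ} (hs : 0 ≤ s) (hm0 : 0 ≤ m) :
    mean s (1 - m) (1 + m) ≤ mean s 0 1 := by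
  refine lintegral_mono fun φ => ennreal_rpow_neg_le (ENNReal.ofReal_le_ofReal ?_) (by linarith)
  nlinarith [mul_nonneg (sq_nonneg (1 - m)) (sq_nonneg (Real.cos (φ / 2))),
    mul_nonneg hm0 (sq_nonneg (Real.sin (φ / 2))),
    mul_nonneg (sq_nonneg m) (sq_nonneg (Real.sin (φ / 2)))]

theorem tendsto_mean_one_sub_one_add {s : ℝ} (hs0 : 0 < s) (hs1 : s < 1) :
    Tendsto (fun m => mean s (1 - m) (1 + m)) (𝓝[<] 1) (𝓝 (mean s 0 2)) := by
  have hpos : ∀ᶠ m : ℝ in 𝓝[<] 1, 0 ≤ m :=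
    nhdsWithin_le_nhds (eventually_ge_nhds (zero_lt_one' ℝ))
  refine tendsto_lintegral_filter_of_dominated_convergence (fun φ => ENNReal.ofReal
      (0 ^ 2 * Real.cos (φ / 2) ^ 2 + 1 ^ 2 * Real.sin (φ / 2) ^ 2) ^ (-(s / 2)))
    (Eventually.of_forall fun m => measurable_mean_integrand s _ _) ?_ ?_ ?_
  · filter_upwards [hpos] with m hm0
    refine ae_of_all _ fun φ => ennreal_rpow_neg_le (ENNReal.ofReal_le_ofReal ?_) (by linarith)
    nlinarith [mul_nonneg (sq_nonneg (1 - m)) (sq_nonneg (Real.cos (φ / 2))),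
      mul_nonneg hm0 (sq_nonneg (Real.sin (φ / 2))),
      mul_nonneg (sq_nonneg m) (sq_nonneg (Real.sin (φ / 2)))]
  · change mean s 0 1 ≠ ⊤
    rw [mean_zero_left_of_lt_one hs1 one_pos]
    exact ENNReal.ofReal_ne_top
  · refine ae_of_all _ fun φ => Tendsto.mono_left ?_ nhdsWithin_le_nhds
    have hc : Continuous fun m : ℝ => ENNReal.ofReal ((1 - m) ^ 2 * Real.cos (φ / 2) ^ 2 +
        (1 + m) ^ 2 * Real.sin (φ / 2) ^ 2) ^ (-(s / 2)) :=
      ENNReal.continuous_rpow_const.comp (ENNReal.continuous_ofReal.comp (by fun_prop))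
    convert hc.tendsto 1 using 4
    norm_num

/-- No asymptotics of the coefficients are needed. They are nonnegative, so each partial sum at `m²`
is at most the mean, hence at most the finite `mean s 0 1`; then `m → 1`. -/
theorem summable_multichoose_sq {s : ℝ} (hs0 : 0 < s) (hs1 : s < 1) :
    Summable fun n => multichoose (s / 2) n * multichoose (s / 2) n := by
  have hne : mean s 0 1 ≠ ⊤ := by
    rw [mean_zero_left_of_lt_one hs1 one_pos]
    exact ENNReal.ofReal_ne_top
  refine summable_of_sum_le (c := (mean s 0 1).toReal) (fun n => mul_self_nonneg _) fun t => ?_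
  have hcont : Continuous fun m : ℝ =>
      ∑ n ∈ t, multichoose (s / 2) n * multichoose (s / 2) n * (m ^ 2) ^ n := by fun_prop
  have hlim := (hcont.tendsto 1).mono_left (nhdsWithin_le_nhds (s := Iio 1))
  simp only [one_pow, mul_one] at hlim
  refine le_of_tendsto hlim ?_
  have hpos : ∀ᶠ m : ℝ in 𝓝[<] 1, 0 ≤ m := nhdsWithin_le_nhds (eventually_ge_nhds (zero_lt_one' ℝ))
  filter_upwards [hpos, self_mem_nhdsWithin] with m hm0 (hm1 : m < 1)
  have hm : |m ^ 2| < 1 := by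
    rw [abs_of_nonneg (sq_nonneg m)]
    nlinarith
  have h := (hasSum_hypergeometric (s / 2) (s / 2) hm)
  refine (h.summable.sum_le_tsum t fun n _ => ?_).trans (h.tsum_eq.le.trans ?_)
  · have := mul_self_nonneg (multichoose (s / 2) n)
    positivity
  · rw [← ENNReal.ofReal_le_iff_le_toReal hne, ← mean_one_sub_one_add s hm0 hm1]
    exact mean_one_sub_one_add_le hs0.le hm0

theorem summable_hypergeometric_sq {s x : ℝ} (hs0 : 0 < s) (hx : x ∈ Icc (0 : ℝ) 1)
    (h : s < 1 ∨ x < 1) :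
    Summable fun n => multichoose (s / 2) n * multichoose (s / 2) n * x ^ n := by
  rcases h with h | h
  · refine (summable_multichoose_sq hs0 h).of_nonneg_of_le (fun n => ?_) fun n => ?_
    · exact mul_nonneg (mul_self_nonneg _) (pow_nonneg hx.1 n)
    · exact mul_le_of_le_one_right (mul_self_nonneg _) (pow_le_one₀ hx.1 hx.2)
  · exact (hasSum_hypergeometric _ _ (abs_lt.2 ⟨by linarith [hx.1], h⟩)).summable

theorem continuousOn_hypergeometric_sq {s : ℝ} (hs0 : 0 < s) (hs1 : s < 1) :
    ContinuousOn (fun x : ℝ => ₂F₁ (s / 2) (s / 2) (1 : ℝ) x) (Icc 0 1) := by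
  simp only [hypergeometric_eq_tsum]
  refine continuousOn_tsum (fun n => by fun_prop) (summable_multichoose_sq hs0 hs1) fun n x hx => ?_
  rw [norm_mul, Real.norm_of_nonneg (mul_self_nonneg _), norm_pow, Real.norm_of_nonneg hx.1]
  exact mul_le_of_le_one_right (mul_self_nonneg _) (pow_le_one₀ hx.1 hx.2)

theorem one_le_hypergeometric_sq {s x : ℝ} (hs0 : 0 < s) (hx : x ∈ Icc (0 : ℝ) 1)
    (h : s < 1 ∨ x < 1) : 1 ≤ ₂F₁ (s / 2) (s / 2) (1 : ℝ) x := by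
  rw [hypergeometric_eq_tsum]
  have := (summable_hypergeometric_sq hs0 hx h).sum_le_tsum {0}
    fun n _ => mul_nonneg (mul_self_nonneg _) (pow_nonneg hx.1 n)
  simpa using this

theorem hypergeometric_sq_lt {s x : ℝ} (hs0 : 0 < s) (hs1 : s < 1) (hx0 : 0 ≤ x) (hx1 : x < 1) :
    ₂F₁ (s / 2) (s / 2) (1 : ℝ) x < ₂F₁ (s / 2) (s / 2) (1 : ℝ) (1 : ℝ) := by
  rw [hypergeometric_eq_tsum, hypergeometric_eq_tsum]
  refine Summable.tsum_lt_tsum (i := 1) (fun n => ?_) ?_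
    (summable_hypergeometric_sq hs0 ⟨hx0, hx1.le⟩ (.inl hs1))
    (summable_hypergeometric_sq hs0 ⟨zero_le_one, le_rfl⟩ (.inl hs1))
  · exact mul_le_mul_of_nonneg_left (by simpa using pow_le_one₀ hx0 hx1.le) (mul_self_nonneg _)
  · have := multichoose_pos (by linarith : 0 < s / 2) 1
    simp only [pow_one]
    gcongr

/-- Both sides are the limit of `mean s (1 - m) (1 + m)` as `m → 1⁻`: one by dominated convergence,
the other by continuity of the series up to `1`. -/
theorem mean_zero_two {s : ℝ} (hs0 : 0 < s) (hs1 : s < 1) :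
    mean s 0 2 = ENNReal.ofReal (₂F₁ (s / 2) (s / 2) (1 : ℝ) (1 : ℝ)) := by
  refine tendsto_nhds_unique (tendsto_mean_one_sub_one_add hs0 hs1) ?_
  have h1 : Tendsto (fun m : ℝ => ₂F₁ (s / 2) (s / 2) (1 : ℝ) (m ^ 2)) (𝓝[<] 1)
      (𝓝 (₂F₁ (s / 2) (s / 2) (1 : ℝ) (1 : ℝ))) := by
    refine (continuousOn_hypergeometric_sq hs0 hs1 1 ⟨zero_le_one, le_rfl⟩).tendsto.comp ?_
    refine tendsto_nhdsWithin_iff.2 ⟨?_, ?_⟩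
    · have : Continuous fun m : ℝ => m ^ 2 := by fun_prop
      simpa using (this.tendsto 1).mono_left (nhdsWithin_le_nhds (s := Iio 1))
    · have hpos : ∀ᶠ m : ℝ in 𝓝[<] 1, 0 ≤ m :=
        nhdsWithin_le_nhds (eventually_ge_nhds (zero_lt_one' ℝ))
      filter_upwards [hpos, self_mem_nhdsWithin] with m hm0 (hm1 : m < 1)
      exact ⟨sq_nonneg m, pow_le_one₀ hm0 hm1.le⟩
  refine ((ENNReal.tendsto_ofReal h1).congr' ?_)
  have hpos : ∀ᶠ m : ℝ in 𝓝[<] 1, 0 ≤ m := nhdsWithin_le_nhds (eventually_ge_nhds (zero_lt_one' ℝ))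
  filter_upwards [hpos, self_mem_nhdsWithin] with m hm0 (hm1 : m < 1)
  rw [mean_one_sub_one_add s hm0 hm1]

/-- Scaling by `(b + a) / 2` reduces to the pair `1 - m`, `1 + m` with `m = (b - a) / (b + a)`; the
case `a = 0` is `m = 1`. -/
theorem mean_eq_ofReal_hypergeometric {s a b : ℝ} (hs : 0 < s) (ha : 0 ≤ a) (hab : a ≤ b)
    (hb : 0 < b) (h : 0 < a ∨ s < 1) :
    mean s a b = ENNReal.ofReal ((2 / (b + a)) ^ s *
      ₂F₁ (s / 2) (s / 2) (1 : ℝ) (((b - a) / (b + a)) ^ 2)) := by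
  have hr : 0 < (b + a) / 2 := by linarith
  have hm0 : 0 ≤ (b - a) / (b + a) := div_nonneg (by linarith) (by linarith)
  have h1 := mean_mul s (1 - (b - a) / (b + a)) (1 + (b - a) / (b + a)) hr
  have h2 : (b + a) / 2 * (1 - (b - a) / (b + a)) = a := by field_simp; ring
  have h3 : (b + a) / 2 * (1 + (b - a) / (b + a)) = b := by field_simp; ring
  have h4 : ((b + a) / 2) ^ (-s) = (2 / (b + a)) ^ s := by
    rw [Real.rpow_neg hr.le, ← Real.inv_rpow hr.le, inv_div]
  rw [h2, h3, h4] at h1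
  rw [h1, ENNReal.ofReal_mul (by positivity)]
  congr 1
  rcases ha.eq_or_lt with rfl | ha
  · have hs1 : s < 1 := h.resolve_left (lt_irrefl 0)
    rw [sub_zero, add_zero, div_self hb.ne', one_pow, ← mean_zero_two hs hs1]
    norm_num
  · exact mean_one_sub_one_add s hm0 ((div_lt_one (by linarith)).2 (by linarith))

/-! ### Limits at argument `1`, small exponents, the elliptic integral, Fatou -/

theorem integral_angle_cos_rpow {p : ℝ} (hp : -1 < p) :
    Integrable (fun φ => (Real.cos (φ / 2) ^ 2) ^ (p / 2)) angle ∧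
      ∫ φ, (Real.cos (φ / 2) ^ 2) ^ (p / 2) ∂angle =
        Real.Gamma ((p + 1) / 2) / (√Real.pi * Real.Gamma (p / 2 + 1)) := by
  have hper : Function.Periodic (fun φ : ℝ => ENNReal.ofReal (Real.sin (φ / 2) ^ 2) ^ (p / 2))
      (2 * Real.pi) := fun φ => by
    simp only [add_div, mul_div_cancel_left₀ _ (two_ne_zero' ℝ), Real.sin_add_pi, neg_sq]
  have h := lintegral_angle_sin_rpow hp
  rw [← lintegral_angle_add Real.pi hper] at h
  simp only [add_div _ Real.pi, Real.sin_add_pi_div_two] at h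
  have hae : ∫⁻ φ, ENNReal.ofReal ((Real.cos (φ / 2) ^ 2) ^ (p / 2)) ∂angle =
      ENNReal.ofReal (Real.Gamma ((p + 1) / 2) / (√Real.pi * Real.Gamma (p / 2 + 1))) := by
    rw [← h]
    refine lintegral_congr_ae ?_
    filter_upwards [ae_angle_cos_ne_zero] with φ hφ
    rw [ENNReal.ofReal_rpow_of_pos (sq_pos_of_ne_zero hφ)]
  have h0 : ∀ φ : ℝ, 0 ≤ (Real.cos (φ / 2) ^ 2) ^ (p / 2) := fun φ => by positivity
  have hmeas : AEStronglyMeasurable (fun φ => (Real.cos (φ / 2) ^ 2) ^ (p / 2)) angle :=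
    (by fun_prop : Measurable _).aestronglyMeasurable
  constructor
  · refine ⟨hmeas, (hasFiniteIntegral_iff_ofReal (ae_of_all _ h0)).2 ?_⟩
    rw [hae]
    exact ENNReal.ofReal_lt_top
  · rw [integral_eq_lintegral_of_nonneg_ae (ae_of_all _ h0) hmeas, hae,
      ENNReal.toReal_ofReal]
    have := Real.Gamma_pos_of_pos (by linarith : 0 < (p + 1) / 2)
    have := Real.Gamma_pos_of_pos (by linarith : 0 < p / 2 + 1)
    positivity

/-- Abel's limit theorem combined with Gauss' summation formula. -/
theorem tendsto_hypergeometric_half {α : ℝ} (hα : α < 1 / 2) :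
    Tendsto (fun k : ℝ => ₂F₁ α (1 / 2) (1 : ℝ) k) (𝓝[<] 1)
      (𝓝 (Real.Gamma (1 / 2 - α) / (√Real.pi * Real.Gamma (1 - α)))) := by
  obtain ⟨hint, hval⟩ := integral_angle_cos_rpow (p := -2 * α) (by linarith)
  rw [show (-2 * α + 1) / 2 = 1 / 2 - α by ring, show -2 * α / 2 + 1 = 1 - α by ring,
    show -2 * α / 2 = -α by ring] at hval
  rw [show -2 * α / 2 = -α by ring] at hint
  rw [← hval]
  have hpos : ∀ᶠ k : ℝ in 𝓝[<] 1, 0 ≤ k := nhdsWithin_le_nhds (eventually_ge_nhds (zero_lt_one' ℝ))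
  have hlim : Tendsto (fun k : ℝ => ∫ φ, (1 - k * Real.sin (φ / 2) ^ 2) ^ (-α) ∂angle) (𝓝[<] 1)
      (𝓝 (∫ φ, (Real.cos (φ / 2) ^ 2) ^ (-α) ∂angle)) := by
    -- The base lies between `cos² (φ/2)` and `1`, so its power is at most `1` for `α ≤ 0` and at
    -- most `(cos² (φ/2))^(-α)` for `α ≥ 0`. The sum covers both and is integrable because `α <
    -- 1/2`.
    refine tendsto_integral_filter_of_dominated_convergence
      (fun φ => 1 + (Real.cos (φ / 2) ^ 2) ^ (-α)) (Eventually.of_forall fun k =>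
        (by fun_prop : Measurable _).aestronglyMeasurable) ?_
      ((integrable_const _).add hint) ?_
    · filter_upwards [hpos, self_mem_nhdsWithin] with k hk0 (hk1 : k < 1)
      filter_upwards [ae_angle_cos_ne_zero] with φ hφ
      have h1 : 0 < Real.cos (φ / 2) ^ 2 := sq_pos_of_ne_zero hφ
      have h2 := Real.sin_sq_add_cos_sq (φ / 2)
      have h3 : Real.cos (φ / 2) ^ 2 ≤ 1 - k * Real.sin (φ / 2) ^ 2 := by
        nlinarith [sq_nonneg (Real.sin (φ / 2))]
      have h4 : 1 - k * Real.sin (φ / 2) ^ 2 ≤ 1 := by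
        nlinarith [mul_nonneg hk0 (sq_nonneg (Real.sin (φ / 2)))]
      have h5 : 0 ≤ (Real.cos (φ / 2) ^ 2) ^ (-α) := by positivity
      rw [Real.norm_of_nonneg (Real.rpow_nonneg (h1.le.trans h3) _)]
      rcases le_total α 0 with hα0 | hα0
      · have := Real.rpow_le_one (h1.le.trans h3) h4 (neg_nonneg.2 hα0)
        linarith
      · have := Real.rpow_le_rpow_of_nonpos h1 h3 (neg_nonpos.2 hα0)
        linarith
    · filter_upwards [ae_angle_cos_ne_zero] with φ hφ
      refine Tendsto.mono_left ?_ nhdsWithin_le_nhds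
      have h1 : 1 - 1 * Real.sin (φ / 2) ^ 2 = Real.cos (φ / 2) ^ 2 := by
        rw [Real.cos_sq', one_mul]
      rw [← h1]
      refine Tendsto.rpow_const ?_ (Or.inl (by rw [h1]; exact (sq_pos_of_ne_zero hφ).ne'))
      exact (by fun_prop : Continuous fun k : ℝ => 1 - k * Real.sin (φ / 2) ^ 2).tendsto 1
  refine hlim.congr' ?_
  filter_upwards [hpos, self_mem_nhdsWithin] with k hk0 (hk1 : k < 1)
  exact integral_one_sub_mul_sin_sq α (abs_lt.2 ⟨by linarith, hk1⟩)

/-- The first coefficient is `σ`, and the later factors `(σ + n) / (n + 1)` increase with `σ`. So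
the coefficients are `O(σ)` relative to those at the fixed value `1/4`, whose squares are summable.
-/
theorem multichoose_le_mul_multichoose_quarter {σ : ℝ} (h0 : 0 ≤ σ) (h1 : σ ≤ 1 / 4) (n : ℕ) :
    multichoose σ (n + 1) ≤ 4 * σ * multichoose (1 / 4 : ℝ) (n + 1) := by
  induction n with
  | zero => simp; linarith
  | succ n ih =>
    rw [multichoose_succ σ (n + 1), multichoose_succ (1 / 4) (n + 1), ← mul_assoc]
    have := multichoose_nonneg (by norm_num : (0 : ℝ) ≤ 1 / 4) (n + 1)
    gcongr

/-- The bound is quadratic in `s` and uniform up to `x = 1`, so the series contributes nothing to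
the derivative at `s = 0`. -/
theorem hypergeometric_sq_sub_one_le {s x : ℝ} (hs0 : 0 < s) (hs1 : s ≤ 1 / 2)
    (hx : x ∈ Icc (0 : ℝ) 1) :
    ₂F₁ (s / 2) (s / 2) (1 : ℝ) x - 1 ≤
      4 * s ^ 2 * ∑' n, multichoose (1 / 4 : ℝ) (n + 1) * multichoose (1 / 4 : ℝ) (n + 1) := by
  have hsum := summable_hypergeometric_sq hs0 hx (.inl (by linarith))
  have hq := summable_multichoose_sq (s := 1 / 2) (by norm_num) (by norm_num)
  rw [show (1 / 2 / 2 : ℝ) = 1 / 4 by norm_num] at hq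
  rw [hypergeometric_eq_tsum, hsum.tsum_eq_zero_add]
  simp only [Ring.multichoose_zero_right, pow_zero, mul_one, add_sub_cancel_left]
  rw [← tsum_mul_left]
  refine Summable.tsum_le_tsum (fun n => ?_) ((summable_nat_add_iff 1).2 hsum)
    (((summable_nat_add_iff 1).2 hq).mul_left _)
  have h1 := multichoose_le_mul_multichoose_quarter (by linarith : 0 ≤ s / 2) (by linarith) n
  have h2 := multichoose_nonneg (by linarith : 0 ≤ s / 2) (n + 1)
  calc _ ≤ multichoose (s / 2) (n + 1) * multichoose (s / 2) (n + 1) :=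
        mul_le_of_le_one_right (mul_self_nonneg _) (pow_le_one₀ hx.1 hx.2)
    _ ≤ (4 * (s / 2) * multichoose (1 / 4 : ℝ) (n + 1)) *
        (4 * (s / 2) * multichoose (1 / 4 : ℝ) (n + 1)) :=
        mul_self_le_mul_self h2 h1
    _ = _ := by ring

/-- With `θ = φ/2` the full average runs over `[0, π]`, which is twice `[0, π/2]` by `θ ↦ π - θ`. -/
theorem ellipticK_eq {m : ℝ} (hm0 : 0 ≤ m) (hm1 : m < 1) :
    ellipticK m = Real.pi / 2 * ₂F₁ (1 / 2) (1 / 2) (1 : ℝ) m := by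
  have hcont : Continuous fun θ : ℝ => (1 - m * Real.sin θ ^ 2) ^ (-(1 / 2) : ℝ) := by
    refine (by fun_prop : Continuous fun θ : ℝ => 1 - m * Real.sin θ ^ 2).rpow_const fun θ => Or.inl ?_
    nlinarith [Real.sin_sq_le_one θ, sq_nonneg (Real.sin θ)]
  have hrefl : ∫ θ in (Real.pi / 2)..Real.pi, (1 - m * Real.sin θ ^ 2) ^ (-(1 / 2) : ℝ) =
      ∫ θ in (0)..(Real.pi / 2), (1 - m * Real.sin θ ^ 2) ^ (-(1 / 2) : ℝ) := by
    have h := intervalIntegral.integral_comp_sub_left (a := Real.pi / 2) (b := Real.pi)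
      (fun θ : ℝ => (1 - m * Real.sin θ ^ 2) ^ (-(1 / 2) : ℝ)) Real.pi
    simpa only [Real.sin_pi_sub, sub_self, sub_half] using h
  have hscale := intervalIntegral.integral_comp_div (a := 0) (b := 2 * Real.pi)
    (fun θ : ℝ => (1 - m * Real.sin θ ^ 2) ^ (-(1 / 2) : ℝ)) (two_ne_zero' ℝ)
  rw [zero_div, mul_div_cancel_left₀ _ (two_ne_zero' ℝ),
    ← intervalIntegral.integral_add_adjacent_intervals (b := Real.pi / 2)
      (hcont.intervalIntegrable _ _) (hcont.intervalIntegrable _ _), hrefl] at hscale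
  rw [← integral_one_sub_mul_sin_sq _ (abs_lt.2 ⟨by linarith, hm1⟩), integral_angle, hscale, ellipticK]
  have heq : ∫ θ in (0 : ℝ)..(Real.pi / 2), 1 / √(1 - m * Real.sin θ ^ 2) =
      ∫ θ in (0)..(Real.pi / 2), (1 - m * Real.sin θ ^ 2) ^ (-(1 / 2) : ℝ) := by
    refine intervalIntegral.integral_congr fun θ _ => ?_
    have h : 0 ≤ 1 - m * Real.sin θ ^ 2 := by
      nlinarith [Real.sin_sq_le_one θ, sq_nonneg (Real.sin θ)]
    rw [Real.rpow_neg h, ← Real.sqrt_eq_rpow, one_div]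
  rw [heq]
  have := Real.pi_pos
  simp only [smul_eq_mul]
  field_simp
  ring

theorem tendsto_mean_toReal {a b s₀ : ℝ} (ha : 0 < a) (hb : 0 < b) :
    Tendsto (fun s => (mean s a b).toReal) (𝓝 s₀) (𝓝 (mean s₀ a b).toReal) := by
  have h (s : ℝ) : (mean s a b).toReal = ∫ φ, (a ^ 2 * Real.cos (φ / 2) ^ 2 +
      b ^ 2 * Real.sin (φ / 2) ^ 2) ^ (-(s / 2)) ∂angle := by
    rw [mean_eq_ofReal_integral ha hb, ENNReal.toReal_ofReal]
    exact integral_nonneg fun φ => Real.rpow_nonneg (quadratic_pos ha hb φ).le _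
  simp only [h]
  -- For `|s - s₀| < 1` the power `q^(-s/2)` is at most the one with `s₀ + 1` if `q ≤ 1`, and the
  -- one with `s₀ - 1` if `q ≥ 1`.
  refine tendsto_integral_filter_of_dominated_convergence (fun φ => (a ^ 2 * Real.cos (φ / 2) ^ 2 +
      b ^ 2 * Real.sin (φ / 2) ^ 2) ^ (-((s₀ + 1) / 2)) + (a ^ 2 * Real.cos (φ / 2) ^ 2 +
      b ^ 2 * Real.sin (φ / 2) ^ 2) ^ (-((s₀ - 1) / 2)))
    (Eventually.of_forall fun s => (by fun_prop : Measurable _).aestronglyMeasurable) ?_ ((integrable_angle_of_continuous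
      (continuous_quadratic_rpow ha hb _)).add (integrable_angle_of_continuous
      (continuous_quadratic_rpow ha hb _))) (ae_of_all _ fun φ => ?_)
  · filter_upwards [Ioo_mem_nhds (sub_one_lt s₀) (lt_add_one s₀)] with s hs
    refine ae_of_all _ fun φ => ?_
    have hq := quadratic_pos ha hb φ
    generalize a ^ 2 * Real.cos (φ / 2) ^ 2 + b ^ 2 * Real.sin (φ / 2) ^ 2 = q at *
    have h1 := Real.rpow_pos_of_pos hq (-((s₀ + 1) / 2))
    have h2 := Real.rpow_pos_of_pos hq (-((s₀ - 1) / 2))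
    rw [Real.norm_of_nonneg (by positivity)]
    rcases le_total q 1 with hq1 | hq1
    · have := Real.rpow_le_rpow_of_exponent_ge hq hq1 (by linarith [hs.2] : -((s₀ + 1) / 2) ≤ -(s / 2))
      linarith
    · have := Real.rpow_le_rpow_of_exponent_le hq1 (by linarith [hs.1] : -(s / 2) ≤ -((s₀ - 1) / 2))
      linarith
  · have hq := quadratic_pos ha hb φ
    exact tendsto_const_nhds.rpow (((continuous_id.div_const 2).neg).tendsto s₀) (Or.inl hq.ne')

/-- Fatou's lemma: the integrand depends continuously on `a` and `b` with values in `[0, ∞]`. It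
serves the blow-up at the diagonal, where the limit is `⊤`. -/
theorem mean_le_liminf {ι : Type*} {l : Filter ι} [l.IsCountablyGenerated] (s : ℝ) {a b : ℝ}
    {A B : ι → ℝ} (hA : Tendsto A l (𝓝 a)) (hB : Tendsto B l (𝓝 b)) :
    mean s a b ≤ liminf (fun i => mean s (A i) (B i)) l := by
  rcases l.eq_or_neBot with rfl | hl
  · simp
  refine le_trans (lintegral_mono fun φ => ?_)
    (lintegral_liminf_le fun i => measurable_mean_integrand s (A i) (B i))
  refine (Tendsto.liminf_eq ?_).ge
  exact (ENNReal.continuous_rpow_const.tendsto _).comp ((ENNReal.continuous_ofReal.tendsto _).comp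
    (((hA.pow 2).mul_const _).add ((hB.pow 2).mul_const _)))

/-! ### The Legendre function -/

/-- The Legendre function of the first kind of degree `s / 2 - 1`, glued from its hypergeometric
series at `1` and the series obtained by Pfaff's transformation. -/
noncomputable def legendre (s x : ℝ) : ℝ :=
  if x < 2 then ₂F₁ (1 - s / 2) (s / 2) (1 : ℝ) ((1 - x) / 2)
  else ((1 + x) / 2) ^ (-(s / 2)) * ₂F₁ (s / 2) (s / 2) (1 : ℝ) ((x - 1) / (x + 1))

theorem analyticOnNhd_legendre_left (s : ℝ) : AnalyticOnNhd ℝ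
    (fun x : ℝ => ₂F₁ (1 - s / 2) (s / 2) (1 : ℝ) ((1 - x) / 2)) (Ioo (-1) 3) := by
  intro x hx
  have h : AnalyticAt ℝ (fun x : ℝ => (1 - x) / 2) x := by fun_prop
  exact (analyticOnNhd_hypergeometric (1 - s / 2) (s / 2) ((1 - x) / 2)
    ⟨by linarith [hx.2], by linarith [hx.1]⟩).comp (f := fun x : ℝ => (1 - x) / 2) h

theorem analyticOnNhd_legendre_right (s : ℝ) : AnalyticOnNhd ℝ
    (fun x : ℝ => ((1 + x) / 2) ^ (-(s / 2)) *
      ₂F₁ (s / 2) (s / 2) (1 : ℝ) ((x - 1) / (x + 1))) (Ioi 0) := by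
  intro x (hx : 0 < x)
  have h1 : AnalyticAt ℝ (fun x : ℝ => (1 + x) / 2) x := by fun_prop
  have h2 : AnalyticAt ℝ (fun x : ℝ => (x - 1) / (x + 1)) x :=
    (analyticAt_id.sub analyticAt_const).div (analyticAt_id.add analyticAt_const)
      (show x + 1 ≠ 0 by linarith)
  refine AnalyticAt.mul ((analyticAt_rpow_const (x := (1 + x) / 2) (by linarith) (-(s / 2))).comp
    (f := fun x : ℝ => (1 + x) / 2) h1) ?_
  refine (analyticOnNhd_hypergeometric (s / 2) (s / 2) ((x - 1) / (x + 1)) ⟨?_, ?_⟩).comp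
    (f := fun x : ℝ => (x - 1) / (x + 1)) h2
  · rw [lt_div_iff₀ (by linarith)]
    linarith
  · rw [div_lt_one (by linarith)]
    linarith

/-- Pfaff's transformation near `x = 1`, extended by the identity theorem to the common interval of
analyticity. The gluing point `2` is thus an arbitrary choice inside it. -/
theorem legendre_left_eq_right (s : ℝ) : EqOn
    (fun x : ℝ => ₂F₁ (1 - s / 2) (s / 2) (1 : ℝ) ((1 - x) / 2))
    (fun x : ℝ => ((1 + x) / 2) ^ (-(s / 2)) *
      ₂F₁ (s / 2) (s / 2) (1 : ℝ) ((x - 1) / (x + 1))) (Ioo 0 3) := by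
  refine ((analyticOnNhd_legendre_left s).mono
    (Ioo_subset_Ioo_left (by norm_num))).eqOn_of_preconnected_of_eventuallyEq
    ((analyticOnNhd_legendre_right s).mono Ioo_subset_Ioi_self) isPreconnected_Ioo (z₀ := 1)
    (by norm_num) ?_
  filter_upwards [Ioo_mem_nhds (by norm_num : (1 / 2 : ℝ) < 1) (by norm_num : (1 : ℝ) < 3 / 2)]
    with x hx
  rw [hypergeometric_pfaff _ _ (abs_lt.2 ⟨by linarith [hx.2], by linarith [hx.1]⟩)]
  congr 2
  · ring
  · ring
  · have : x + 1 ≠ 0 := by linarith [hx.1]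
    rw [show 1 - (1 - x) / 2 = (x + 1) / 2 by ring]
    field_simp
    ring

theorem isLegendreP_legendre (s : ℝ) : IsLegendreP (s / 2 - 1) (legendre s) := by
  constructor
  · intro x (hx : -1 < x)
    rcases lt_or_ge x 2 with h | h
    · refine (analyticOnNhd_legendre_left s x ⟨hx, by linarith⟩).congr ?_
      filter_upwards [gt_mem_nhds h] with y hy
      rw [legendre, if_pos hy]
    · refine (analyticOnNhd_legendre_right s x (by linarith : 0 < x)).congr ?_
      filter_upwards [lt_mem_nhds (by linarith : 1 < x)] with y hy
      rw [legendre]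
      split_ifs with hy2
      · exact (legendre_left_eq_right s ⟨by linarith, by linarith⟩).symm
      · rfl
  · intro x hx
    obtain ⟨h1, h2⟩ := abs_lt.1 hx
    rw [show -(s / 2 - 1) = 1 - s / 2 by ring, sub_add_cancel, legendre]
    split_ifs with h
    · rfl
    · exact (legendre_left_eq_right s ⟨by linarith, by linarith⟩).symm

/-- The identity theorem determines every admissible `P`. One formula on the positive axis suffices,
since `legendreArg z w > 0` for distinct points of the half-plane. -/
theorem IsLegendreP.eq_of_pos {s : ℝ} {P : ℝ → ℝ} (hP : IsLegendreP (s / 2 - 1) P) {x : ℝ}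
    (hx : 0 < x) : P x = ((1 + x) / 2) ^ (-(s / 2)) *
      ₂F₁ (s / 2) (s / 2) (1 : ℝ) ((x - 1) / (x + 1)) := by
  refine (hP.1.mono (Ioi_subset_Ioi (by norm_num))).eqOn_of_preconnected_of_eventuallyEq
    (analyticOnNhd_legendre_right s) isPreconnected_Ioi (z₀ := 1) (mem_Ioi.2 one_pos) ?_ hx
  filter_upwards [Ioo_mem_nhds (by norm_num : (1 / 2 : ℝ) < 1) (by norm_num : (1 : ℝ) < 3 / 2)]
    with y hy
  rw [hP.2 y (abs_lt.2 ⟨by linarith [hy.2], by linarith [hy.1]⟩),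
    show -(s / 2 - 1) = 1 - s / 2 by ring, sub_add_cancel]
  exact legendre_left_eq_right s ⟨by linarith [hy.1], by linarith [hy.2]⟩

/-! ### The geometry of the half-plane -/

theorem continuous_reflect : Continuous reflect := by
  unfold reflect
  fun_prop

theorem norm_sub_reflect_comm (z w : ℂ) : ‖w - reflect z‖ = ‖z - reflect w‖ := by
  rw [← Complex.norm_conj]
  congr 1
  simp only [reflect, map_sub, map_neg, Complex.conj_conj]
  ring

theorem norm_sub_reflect_sq (z w : ℂ) :
    ‖z - reflect w‖ ^ 2 = ‖z - w‖ ^ 2 + 4 * z.re * w.re := by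
  rw [Complex.sq_norm, Complex.sq_norm, Complex.normSq_apply, Complex.normSq_apply]
  simp [reflect]
  ring

theorem norm_self_sub_reflect (w : ℂ) : ‖w - reflect w‖ = 2 * |w.re| := by
  have h := norm_sub_reflect_sq w w
  rw [sub_self, norm_zero] at h
  have h2 : ‖w - reflect w‖ ^ 2 = (2 * |w.re|) ^ 2 := by rw [h, mul_pow, sq_abs]; ring
  exact (pow_left_inj₀ (norm_nonneg _) (by positivity) two_ne_zero).1 h2

theorem norm_sub_le_norm_sub_reflect {z w : ℂ} (hz : z ∈ halfPlane) (hw : w ∈ halfPlane) :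
    ‖z - w‖ ≤ ‖z - reflect w‖ := by
  refine (pow_le_pow_iff_left₀ (norm_nonneg _) (norm_nonneg _) two_ne_zero).1 ?_
  rw [norm_sub_reflect_sq]
  have : 0 ≤ z.re * w.re := mul_nonneg hz hw
  linarith

theorem norm_sub_lt_norm_sub_reflect {z w : ℂ} (hz : 0 < z.re) (hw : 0 < w.re) :
    ‖z - w‖ < ‖z - reflect w‖ := by
  refine (pow_lt_pow_iff_left₀ (norm_nonneg _) (norm_nonneg _) two_ne_zero).1 ?_
  rw [norm_sub_reflect_sq]
  have := mul_pos hz hw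
  linarith

theorem norm_sub_reflect_pos {z w : ℂ} (hz : z ∈ halfPlane) (hw : w ∈ halfPlane)
    (h : z ≠ w ∨ 0 < w.re) : 0 < ‖z - reflect w‖ := by
  by_cases hzw : z = w
  · subst hzw
    rw [norm_self_sub_reflect]
    have := h.resolve_left (by simp)
    positivity
  · exact (norm_pos_iff.2 (sub_ne_zero.2 hzw)).trans_le (norm_sub_le_norm_sub_reflect hz hw)

theorem modulus_sq_mem {z w : ℂ} (hz : z ∈ halfPlane) (hw : w ∈ halfPlane) :
    modulus z w ^ 2 ∈ Icc (0 : ℝ) 1 := by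
  have h := norm_sub_le_norm_sub_reflect hz hw
  have h0 := norm_nonneg (z - w)
  refine ⟨sq_nonneg _, pow_le_one₀ (div_nonneg (by linarith) (by linarith)) ?_⟩
  exact div_le_one_of_le₀ (by linarith) (by linarith)

theorem modulus_sq_lt_one {z w : ℂ} (hz : z ∈ halfPlane) (hw : w ∈ halfPlane) (h : z ≠ w) :
    modulus z w ^ 2 < 1 := by
  have h1 := norm_sub_le_norm_sub_reflect hz hw
  have h0 := norm_pos_iff.2 (sub_ne_zero.2 h)
  refine pow_lt_one₀ (div_nonneg (by linarith) (by linarith)) ?_ two_ne_zero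
  exact (div_lt_one (by linarith)).2 (by linarith)

theorem continuousAt_modulus_sq {z w : ℂ} (h : 0 < ‖z - reflect w‖) :
    ContinuousAt (fun p : ℂ × ℂ => modulus p.1 p.2 ^ 2) (z, w) := by
  have h0 := norm_nonneg (z - w)
  have hc := continuous_reflect
  unfold modulus
  refine ContinuousAt.pow (ContinuousAt.div (by fun_prop) (by fun_prop) ?_) 2
  simp only
  linarith

/-! ### Representations of the kernel -/

theorem extKernel_eq_ofReal {s : ℝ} (hs : 0 < s) {z w : ℂ} (hz : z ∈ halfPlane)
    (hw : w ∈ halfPlane) (h : z ≠ w ∨ (s < 1 ∧ 0 < w.re)) :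
    extKernel s z w = ENNReal.ofReal ((2 / (‖z - reflect w‖ + ‖z - w‖)) ^ s *
      ₂F₁ (s / 2) (s / 2) (1 : ℝ) (modulus z w ^ 2)) := by
  rw [extKernel_eq_mean, modulus]
  exact mean_eq_ofReal_hypergeometric hs (norm_nonneg _) (norm_sub_le_norm_sub_reflect hz hw)
    (norm_sub_reflect_pos hz hw (h.imp_right And.right))
    (h.imp (fun h => norm_pos_iff.2 (sub_ne_zero.2 h)) And.left)

theorem hypergeometric_modulus_pos {s : ℝ} (hs : 0 < s) {z w : ℂ} (hz : z ∈ halfPlane)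
    (hw : w ∈ halfPlane) (h : z ≠ w ∨ s < 1) :
    1 ≤ ₂F₁ (s / 2) (s / 2) (1 : ℝ) (modulus z w ^ 2) :=
  one_le_hypergeometric_sq hs (modulus_sq_mem hz hw)
    (h.symm.imp_right fun h => modulus_sq_lt_one hz hw h)

theorem kernel_eq {s : ℝ} (hs : 0 < s) {z w : ℂ} (hz : z ∈ halfPlane)
    (hw : w ∈ halfPlane) (h : z ≠ w ∨ (s < 1 ∧ 0 < w.re)) :
    kernel s z w = (2 / (‖z - reflect w‖ + ‖z - w‖)) ^ s *
      ₂F₁ (s / 2) (s / 2) (1 : ℝ) (modulus z w ^ 2) := by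
  rw [kernel, extKernel_eq_ofReal hs hz hw h, ENNReal.toReal_ofReal]
  have := hypergeometric_modulus_pos hs hz hw (h.imp_right And.left)
  positivity

theorem kernel_eq_half {s : ℝ} (hs : 0 < s) {z w : ℂ} (hz : z ∈ halfPlane)
    (hw : w ∈ halfPlane) (h : z ≠ w ∨ 0 < w.re) :
    kernel s z w = ‖z - reflect w‖ ^ (-s) *
      ₂F₁ (s / 2) (1 / 2) (1 : ℝ) (1 - ‖z - w‖ ^ 2 / ‖z - reflect w‖ ^ 2) := by
  rw [kernel, extKernel_eq_mean]
  exact toReal_mean_eq hs (norm_nonneg _) (norm_sub_le_norm_sub_reflect hz hw)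
    (norm_sub_reflect_pos hz hw h)

/-- In Euler's transformation `1 - x` is `(|z - w| / |z - w_*|)²` and the exponent is `(1 - s) / 2`;
this isolates the singular power of `|z - w|`. -/
theorem kernel_eq_euler {s : ℝ} (hs : 0 < s) {z w : ℂ} (hz : z ∈ halfPlane)
    (hw : w ∈ halfPlane) (h : z ≠ w) :
    kernel s z w = ‖z - w‖ ^ (1 - s) / ‖z - reflect w‖ *
      ₂F₁ (1 - s / 2) (1 / 2) (1 : ℝ) (1 - ‖z - w‖ ^ 2 / ‖z - reflect w‖ ^ 2) := by
  have ha := norm_pos_iff.2 (sub_ne_zero.2 h)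
  have hb := norm_sub_reflect_pos hz hw (.inl h)
  have hab := norm_sub_le_norm_sub_reflect hz hw
  have hq : ‖z - w‖ ^ 2 / ‖z - reflect w‖ ^ 2 ≤ 1 := (div_le_one (by positivity)).2 (by gcongr)
  have hq0 : 0 < ‖z - w‖ ^ 2 / ‖z - reflect w‖ ^ 2 := by positivity
  rw [kernel_eq_half hs hz hw (.inl h), hypergeometric_euler _ _ ⟨by linarith, by linarith⟩,
    ← mul_assoc, sub_sub_cancel]
  congr 1
  · rw [Real.div_rpow (by positivity) (by positivity), ← Real.rpow_natCast_mul ha.le,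
      ← Real.rpow_natCast_mul hb.le]
    have h1 : ((2 : ℕ) : ℝ) * (1 - s / 2 - 1 / 2) = 1 - s := by push_cast; ring
    rw [h1, Real.rpow_neg hb.le, Real.rpow_sub hb, Real.rpow_one]
    have := Real.rpow_pos_of_pos hb s
    field_simp
  · norm_num

/-- For `X = legendreArg z w`, `(1 + X) / 2 = (a + b)² / (4ab)` and `(X - 1) / (X + 1) = ((b - a) /
(b + a))²`, so the Legendre formula is the Parseval one rewritten. -/
theorem kernel_eq_legendre {s : ℝ} (hs : 0 < s) {P : ℝ → ℝ} (hP : IsLegendreP (s / 2 - 1) P)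
    {z w : ℂ} (hz : z ∈ halfPlane) (hw : w ∈ halfPlane) (h : z ≠ w) :
    kernel s z w = ‖z - reflect w‖ ^ (-s / 2) * ‖z - w‖ ^ (-s / 2) * P (legendreArg z w) := by
  have ha := norm_pos_iff.2 (sub_ne_zero.2 h)
  have hb := norm_sub_reflect_pos hz hw (.inl h)
  rw [kernel_eq hs hz hw (.inl h), legendreArg, hP.eq_of_pos (by positivity), modulus]
  generalize ‖z - w‖ = a at *
  generalize ‖z - reflect w‖ = b at *
  rw [← mul_assoc, ← Real.mul_rpow hb.le ha.le, ← neg_div, ← Real.mul_rpow (by positivity) (by positivity)]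
  congr 1
  · rw [show b * a * ((1 + (1 / 2 * (a / b) + 1 / 2 * (b / a))) / 2) = ((b + a) / 2) ^ 2 by
      field_simp; ring, ← Real.rpow_natCast_mul (by positivity),
      show ((2 : ℕ) : ℝ) * (-s / 2) = -s by push_cast; ring, Real.rpow_neg (by positivity),
      ← Real.inv_rpow (by positivity), inv_div]
  · congr 1
    field_simp
    ring

theorem one_lt_legendreArg {z w : ℂ} (hz : 0 < z.re) (hw : 0 < w.re) (h : z ≠ w) :
    1 < legendreArg z w := by
  have ha := norm_pos_iff.2 (sub_ne_zero.2 h)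
  have hab := norm_sub_lt_norm_sub_reflect hz hw
  rw [legendreArg]
  generalize ‖z - w‖ = a at *
  generalize ‖z - reflect w‖ = b at *
  have hb : 0 < b := ha.trans hab
  rw [show 1 / 2 * (a / b) + 1 / 2 * (b / a) = 1 + (b - a) ^ 2 / (2 * a * b) by field_simp; ring]
  have : 0 < (b - a) ^ 2 / (2 * a * b) := by
    have : 0 < b - a := by linarith
    positivity
  linarith

/-! ### Elementary properties -/

theorem extKernel_comm (s : ℝ) (z w : ℂ) : extKernel s z w = extKernel s w z := by
  rw [extKernel_eq_mean, extKernel_eq_mean, norm_sub_rev, norm_sub_reflect_comm]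

theorem extKernel_mul (s : ℝ) (z w : ℂ) {r : ℝ} (hr : 0 < r) :
    extKernel s (r * z) (r * w) = ENNReal.ofReal (r ^ (-s)) * extKernel s z w := by
  have h1 : reflect (r * w) = r * reflect w := by
    simp only [reflect, map_mul, Complex.conj_ofReal, mul_neg]
  rw [extKernel_eq_mean, extKernel_eq_mean, ← mean_mul s _ _ hr, h1, ← mul_sub, ← mul_sub, norm_mul,
    norm_mul, Complex.norm_real, Real.norm_of_nonneg hr.le]

theorem extKernel_lt_top {s : ℝ} (hs : 0 < s) {z w : ℂ} (hz : z ∈ halfPlane)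
    (hw : w ∈ halfPlane) (h : z ≠ w ∨ (s < 1 ∧ 0 < w.re)) : extKernel s z w < ⊤ := by
  rw [extKernel_eq_ofReal hs hz hw h]
  exact ENNReal.ofReal_lt_top

theorem extKernel_self (s : ℝ) (w : ℂ) : extKernel s w w = mean s 0 (2 * |w.re|) := by
  rw [extKernel_eq_mean, sub_self, norm_zero, norm_self_sub_reflect]

/-! ### Continuity -/

theorem continuousAt_factor {z w : ℂ} (s : ℝ) (h : 0 < ‖z - reflect w‖) :
    ContinuousAt (fun p : ℂ × ℂ => (2 / (‖p.1 - reflect p.2‖ + ‖p.1 - p.2‖)) ^ s) (z, w) := by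
  have h0 := norm_nonneg (z - w)
  have hc := continuous_reflect
  have h1 : ‖z - reflect w‖ + ‖z - w‖ ≠ 0 := by linarith
  refine ContinuousAt.rpow_const (ContinuousAt.div (by fun_prop) (by fun_prop) h1) (Or.inl ?_)
  exact div_ne_zero two_ne_zero h1

theorem continuousWithinAt_kernel {s : ℝ} (hs : 0 < s) {z w : ℂ} (hz : z ∈ halfPlane)
    (hw : w ∈ halfPlane) (h : z ≠ w) :
    ContinuousWithinAt (fun p : ℂ × ℂ => kernel s p.1 p.2) (halfPlane ×ˢ halfPlane) (z, w) := by
  have hb := norm_sub_reflect_pos hz hw (.inl h)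
  have h1 := modulus_sq_lt_one hz hw h
  have h2 := modulus_sq_mem hz hw
  have hF := (analyticOnNhd_hypergeometric (s / 2) (s / 2) (modulus z w ^ 2)
    ⟨by linarith [h2.1], h1⟩).continuousAt
  have hc := (continuousAt_factor s hb).mul
    (ContinuousAt.comp (f := fun p : ℂ × ℂ => modulus p.1 p.2 ^ 2) hF (continuousAt_modulus_sq hb))
  refine hc.continuousWithinAt.congr_of_eventuallyEq ?_ (kernel_eq hs hz hw (.inl h))
  have hne : ∀ᶠ p : ℂ × ℂ in 𝓝 (z, w), p.1 ≠ p.2 :=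
    (isOpen_ne_fun continuous_fst continuous_snd).mem_nhds h
  filter_upwards [self_mem_nhdsWithin, nhdsWithin_le_nhds hne] with p hp hp'
  exact kernel_eq hs hp.1 hp.2 (.inl hp')

/-- The squared modulus equals `1` on the diagonal, where the series is known to be continuous only
within `[0, 1]`; the half-plane keeps it in that interval. -/
theorem continuousWithinAt_kernel_diag {s : ℝ} (hs0 : 0 < s) (hs1 : s < 1) {w : ℂ}
    (hw : 0 < w.re) :
    ContinuousWithinAt (fun p : ℂ × ℂ => kernel s p.1 p.2) (halfPlane ×ˢ halfPlane) (w, w) := by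
  have hw' : w ∈ halfPlane := hw.le
  have hb := norm_sub_reflect_pos hw' hw' (.inr hw)
  have hF := continuousOn_hypergeometric_sq hs0 hs1 _ (modulus_sq_mem hw' hw')
  have hc := (continuousAt_factor s hb).continuousWithinAt.mul
    (ContinuousWithinAt.comp (f := fun p : ℂ × ℂ => modulus p.1 p.2 ^ 2) (x := (w, w)) hF
      (continuousAt_modulus_sq hb).continuousWithinAt
      fun p (hp : p ∈ halfPlane ×ˢ halfPlane) => modulus_sq_mem hp.1 hp.2)
  refine hc.congr_of_eventuallyEq ?_ (kernel_eq hs0 hw' hw' (.inr ⟨hs1, hw⟩))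
  have hpos : ∀ᶠ p : ℂ × ℂ in 𝓝 (w, w), 0 < p.2.re :=
    (isOpen_lt continuous_const (Complex.continuous_re.comp continuous_snd)).mem_nhds hw
  filter_upwards [self_mem_nhdsWithin, nhdsWithin_le_nhds hpos] with p hp hp'
  exact kernel_eq hs0 hp.1 hp.2 (.inr ⟨hs1, hp'⟩)

/-! ### The singularity on the diagonal -/

theorem extKernel_self_eq_top {s : ℝ} (hs : 1 ≤ s) (w : ℂ) : extKernel s w w = ⊤ := by
  rw [extKernel_self]
  exact mean_zero_left_eq_top hs (by positivity)

/-- By Fatou the lower limit is at least the diagonal value `⊤`. This also covers `w` on the axis.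
-/
theorem tendsto_kernel_diag_atTop {s : ℝ} (hs : 1 ≤ s) (w : ℂ) :
    Tendsto (fun p : ℂ × ℂ => kernel s p.1 p.2)
      (𝓝[{p ∈ halfPlane ×ˢ halfPlane | p.1 ≠ p.2}] (w, w)) atTop := by
  have hc := continuous_reflect
  have hA : Continuous fun p : ℂ × ℂ => ‖p.1 - p.2‖ := by fun_prop
  have hB : Continuous fun p : ℂ × ℂ => ‖p.1 - reflect p.2‖ := by fun_prop
  have h := mean_le_liminf s ((hA.tendsto (w, w)).mono_left nhdsWithin_le_nhds)
    ((hB.tendsto (w, w)).mono_left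
      (nhdsWithin_le_nhds (s := {p ∈ halfPlane ×ˢ halfPlane | p.1 ≠ p.2})))
  rw [← extKernel_eq_mean, extKernel_self_eq_top hs] at h
  refine tendsto_atTop.2 fun M => ?_
  have hM : ENNReal.ofReal M < liminf (fun p : ℂ × ℂ => mean s ‖p.1 - p.2‖ ‖p.1 - reflect p.2‖)
      (𝓝[{p ∈ halfPlane ×ˢ halfPlane | p.1 ≠ p.2}] (w, w)) :=
    ENNReal.ofReal_lt_top.trans_le h
  filter_upwards [eventually_lt_of_lt_liminf hM, self_mem_nhdsWithin] with p hp hmem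
  rw [← extKernel_eq_mean] at hp
  exact (ENNReal.ofReal_le_iff_le_toReal (extKernel_lt_top (by linarith) hmem.1.1 hmem.1.2
    (.inl hmem.2)).ne).1 hp.le

theorem kernel_of_re_eq_zero {s : ℝ} (hs : 0 < s) {z w : ℂ} (hz : z ∈ halfPlane)
    (hw : w.re = 0) (h : z ≠ w) : kernel s z w = ‖z - w‖ ^ (-s) := by
  have hr : reflect w = w := by
    apply Complex.ext <;> simp [reflect, hw]
  have ha := norm_pos_iff.2 (sub_ne_zero.2 h)
  rw [kernel_eq hs hz (hw.ge : w ∈ halfPlane) (.inl h), modulus, hr, sub_self, zero_div,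
    zero_pow two_ne_zero, ordinaryHypergeometric_zero, mul_one, Real.rpow_neg ha.le,
    ← Real.inv_rpow ha.le]
  congr 1
  field_simp
  norm_num

theorem tendsto_norm_rpow_mul_kernel {s : ℝ} (hs : 1 < s) {w : ℂ} (hw : 0 < w.re) :
    Tendsto (fun z : ℂ => ‖z - w‖ ^ (s - 1) * kernel s z w) (𝓝[≠] w)
      (𝓝 (Real.Gamma ((s - 1) / 2) / (√Real.pi * Real.Gamma (s / 2)) *
        (1 / ‖w - reflect w‖))) := by
  have hw' : w ∈ halfPlane := hw.le
  have hbw := norm_sub_reflect_pos hw' hw' (.inr hw)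
  -- Since `Re w > 0`, all `z` close to `w` lie in the half-plane, so the full punctured
  -- neighbourhood may be used.
  have hpos : ∀ᶠ z : ℂ in 𝓝[≠] w, 0 < z.re :=
    nhdsWithin_le_nhds ((isOpen_lt continuous_const Complex.continuous_re).mem_nhds hw)
  have hF := tendsto_hypergeometric_half (α := 1 - s / 2) (by linarith)
  rw [show 1 / 2 - (1 - s / 2) = (s - 1) / 2 by ring, sub_sub_cancel] at hF
  have hb : Tendsto (fun z : ℂ => ‖z - reflect w‖) (𝓝[≠] w) (𝓝 ‖w - reflect w‖) :=
    ((by fun_prop : Continuous fun z : ℂ => ‖z - reflect w‖).tendsto w).mono_left nhdsWithin_le_nhds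
  have ha : Tendsto (fun z : ℂ => ‖z - w‖) (𝓝[≠] w) (𝓝 0) := by
    have := ((by fun_prop : Continuous fun z : ℂ => ‖z - w‖).tendsto w).mono_left
      (nhdsWithin_le_nhds (s := {w}ᶜ))
    simpa using this
  have hk : Tendsto (fun z : ℂ => 1 - ‖z - w‖ ^ 2 / ‖z - reflect w‖ ^ 2) (𝓝[≠] w) (𝓝[<] 1) := by
    refine tendsto_nhdsWithin_iff.2 ⟨?_, ?_⟩
    · have := tendsto_const_nhds (x := (1 : ℝ)).sub ((ha.pow 2).div (hb.pow 2) (by positivity))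
      simpa using this
    · filter_upwards [hpos, self_mem_nhdsWithin] with z hz hzw
      have h1 := norm_pos_iff.2 (sub_ne_zero.2 hzw)
      have h2 := norm_sub_reflect_pos (hz.le : z ∈ halfPlane) hw' (.inl hzw)
      have : 0 < ‖z - w‖ ^ 2 / ‖z - reflect w‖ ^ 2 := by positivity
      simp only [mem_Iio]
      linarith
  have hlim := (hF.comp hk).mul (hb.inv₀ hbw.ne')
  rw [← one_div] at hlim
  refine hlim.congr' ?_
  filter_upwards [hpos, self_mem_nhdsWithin] with z hz hzw
  have h1 := norm_pos_iff.2 (sub_ne_zero.2 hzw)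
  rw [kernel_eq_euler (by linarith) (hz.le : z ∈ halfPlane) hw' hzw, ← mul_assoc, ← mul_div_assoc,
    ← Real.rpow_add h1, show s - 1 + (1 - s) = 0 by ring, Real.rpow_zero, Function.comp_apply]
  ring

/-! ### Monotonicity -/

theorem extKernel_lt_vertical {s : ℝ} (hs : 0 < s) {u v t t' : ℝ} (h : |t - v| < |t' - v|) :
    extKernel s ⟨u, t'⟩ ⟨u, v⟩ < extKernel s ⟨u, t⟩ ⟨u, v⟩ := by
  have ha (t : ℝ) : ‖(⟨u, t⟩ : ℂ) - ⟨u, v⟩‖ ^ 2 = |t - v| ^ 2 := by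
    rw [Complex.sq_norm, Complex.normSq_apply, sq_abs]
    simp
    ring
  have hlt : ‖(⟨u, t⟩ : ℂ) - ⟨u, v⟩‖ ^ 2 < ‖(⟨u, t'⟩ : ℂ) - ⟨u, v⟩‖ ^ 2 := by
    rw [ha, ha]
    gcongr
  rw [extKernel_eq_mean, extKernel_eq_mean]
  refine mean_lt_mean hs (norm_nonneg _) (norm_nonneg _) ?_ ?_
  · exact (pow_lt_pow_iff_left₀ (norm_nonneg _) (norm_nonneg _) two_ne_zero).1 hlt
  · refine (pow_lt_pow_iff_left₀ (norm_nonneg _) (norm_nonneg _) two_ne_zero).1 ?_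
    rw [norm_sub_reflect_sq, norm_sub_reflect_sq]
    simpa using hlt

theorem extKernel_lt_horizontal {s : ℝ} (hs : 0 < s) {u y t t' : ℝ} (hu : 0 ≤ u) (ht : 0 < t)
    (h : t < t') : extKernel s ⟨u, y⟩ ⟨u + t', y⟩ < extKernel s ⟨u, y⟩ ⟨u + t, y⟩ := by
  have ha (t : ℝ) : ‖(⟨u, y⟩ : ℂ) - ⟨u + t, y⟩‖ ^ 2 = t ^ 2 := by
    rw [Complex.sq_norm, Complex.normSq_apply]
    simp
    ring
  have hlt : t ^ 2 < t' ^ 2 := by gcongr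
  rw [extKernel_eq_mean, extKernel_eq_mean]
  refine mean_lt_mean hs (norm_nonneg _) (norm_nonneg _) ?_ ?_
  · refine (pow_lt_pow_iff_left₀ (norm_nonneg _) (norm_nonneg _) two_ne_zero).1 ?_
    rwa [ha, ha]
  · refine (pow_lt_pow_iff_left₀ (norm_nonneg _) (norm_nonneg _) two_ne_zero).1 ?_
    rw [norm_sub_reflect_sq, norm_sub_reflect_sq, ha, ha]
    have : u * t ≤ u * t' := by gcongr
    simp only
    linarith

/-- By the triangle inequality `|w - w_*| ≤ |z - w_*| + |z - w|`, the prefactor is largest at `z =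
w`. The series is strictly largest at modulus `1`, attained there. -/
theorem extKernel_lt_self {s : ℝ} (hs0 : 0 < s) (hs1 : s < 1) {z w : ℂ} (hz : z ∈ halfPlane)
    (hw : 0 < w.re) (h : z ≠ w) : extKernel s z w < extKernel s w w := by
  have hw' : w ∈ halfPlane := hw.le
  have hb := norm_sub_reflect_pos hw' hw' (.inr hw)
  have hmod : modulus w w = 1 := by
    rw [modulus, sub_self, norm_zero, sub_zero, add_zero, div_self hb.ne']
  have htri : ‖w - reflect w‖ ≤ ‖z - reflect w‖ + ‖z - w‖ := by
    have := norm_sub_le (z - reflect w) (z - w)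
    rwa [sub_sub_sub_cancel_left] at this
  have hF1 := hypergeometric_modulus_pos hs0 hz hw' (.inl h)
  have hF := hypergeometric_sq_lt hs0 hs1 (modulus_sq_mem hz hw').1 (modulus_sq_lt_one hz hw' h)
  rw [extKernel_eq_ofReal hs0 hz hw' (.inl h), extKernel_eq_ofReal hs0 hw' hw' (.inr ⟨hs1, hw⟩),
    hmod, one_pow, sub_self, norm_zero, add_zero]
  have hpow : (2 / (‖z - reflect w‖ + ‖z - w‖)) ^ s ≤ (2 / ‖w - reflect w‖) ^ s := by gcongr
  have hp : 0 < (2 / ‖w - reflect w‖) ^ s := by positivity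
  refine (ENNReal.ofReal_lt_ofReal_iff (by nlinarith)).2 ?_
  calc _ ≤ (2 / ‖w - reflect w‖) ^ s * ₂F₁ (s / 2) (s / 2) (1 : ℝ) (modulus z w ^ 2) := by gcongr
    _ < _ := by gcongr

theorem extKernel_self_eq_reflect (s : ℝ) (w : ℂ) :
    extKernel s w w = extKernel s (reflect w) w := by
  rw [extKernel_eq_mean, extKernel_eq_mean, mean_comm, sub_self, sub_self, norm_sub_rev]

/-! ### The energy of the circle -/

theorem circleMeasure_eq : circleMeasure = angle.map (circleMap 0 1) := by
  rw [circleMeasure, angle, Measure.map_smul]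

theorem enorm_circleMap_sub_rpow (s θ ψ : ℝ) :
    ‖circleMap 0 1 θ - circleMap 0 1 ψ‖ₑ ^ (-s) =
      ENNReal.ofReal (0 ^ 2 * Real.cos ((ψ - θ) / 2) ^ 2 + 2 ^ 2 * Real.sin ((ψ - θ) / 2) ^ 2) ^
        (-(s / 2)) := by
  have h : ‖circleMap 0 1 θ - circleMap 0 1 ψ‖ ^ 2 =
      0 ^ 2 * Real.cos ((ψ - θ) / 2) ^ 2 + 2 ^ 2 * Real.sin ((ψ - θ) / 2) ^ 2 := by
    have hc : Real.cos (ψ - θ) = 1 - 2 * Real.sin ((ψ - θ) / 2) ^ 2 := by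
      rw [Real.sin_sq_eq_half_sub, mul_div_cancel₀ _ two_ne_zero]
      ring
    have h1 := Real.sin_sq_add_cos_sq θ
    have h2 := Real.sin_sq_add_cos_sq ψ
    rw [Real.cos_sub] at hc
    rw [Complex.sq_norm, Complex.normSq_apply]
    simp only [circleMap, zero_add, Complex.ofReal_one, one_mul, Complex.sub_re, Complex.sub_im,
      Complex.exp_ofReal_mul_I_re, Complex.exp_ofReal_mul_I_im]
    linarith
  rw [← h, ENNReal.ofReal_pow (norm_nonneg _), ofReal_norm, ← ENNReal.rpow_natCast_mul]
  congr 1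
  push_cast
  ring

/-- The chord is `2 |sin ((ψ - θ) / 2)|`; by rotation invariance the inner potential is constant on
the circle. -/
theorem rieszEnergy_circleMeasure (s : ℝ) : rieszEnergy s circleMeasure = mean s 0 2 := by
  have hm : Measurable (circleMap 0 1) := (continuous_circleMap 0 1).measurable
  have hmeas : Measurable (Function.uncurry fun x y : ℂ => ‖x - y‖ₑ ^ (-s)) := by
    unfold Function.uncurry
    fun_prop
  have hmeas' : Measurable fun x : ℂ =>
      ∫⁻ y, ‖x - y‖ₑ ^ (-s) ∂angle.map (circleMap 0 1) := hmeas.lintegral_prod_right'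
  rw [rieszEnergy, circleMeasure_eq, lintegral_map hmeas' hm]
  have hinner (θ : ℝ) : ∫⁻ y, ‖circleMap 0 1 θ - y‖ₑ ^ (-s) ∂angle.map (circleMap 0 1) =
      mean s 0 2 := by
    rw [lintegral_map (by fun_prop) hm]
    simp only [enorm_circleMap_sub_rpow, sub_eq_add_neg _ θ]
    refine lintegral_angle_add (-θ) (f := fun ψ => ENNReal.ofReal (0 ^ 2 * Real.cos (ψ / 2) ^ 2 +
      2 ^ 2 * Real.sin (ψ / 2) ^ 2) ^ (-(s / 2))) fun ψ => ?_
    simp only [add_div, mul_div_cancel_left₀ _ (two_ne_zero' ℝ), Real.cos_add_pi, Real.sin_add_pi,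
      neg_sq]
  simp only [hinner, lintegral_const, measure_univ, mul_one]

theorem extKernel_self_eq_rieszEnergy (s : ℝ) {w : ℂ} (hw : 0 < w.re) :
    extKernel s w w = rieszEnergy s circleMeasure * ENNReal.ofReal (|w.re| ^ (-s)) := by
  have h := mean_mul s 0 2 (abs_pos.2 hw.ne')
  rw [mul_zero, mul_comm |w.re|] at h
  rw [extKernel_self, h, rieszEnergy_circleMeasure, mul_comm]

theorem rieszEnergy_circleMeasure_eq {s : ℝ} (hs : s < 1) :
    rieszEnergy s circleMeasure = ENNReal.ofReal (2 ^ (-s) * (Real.Gamma ((1 - s) / 2) /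
      (√Real.pi * Real.Gamma (1 - s / 2)))) := by
  rw [rieszEnergy_circleMeasure, mean_zero_left_of_lt_one hs two_pos]

/-- Legendre's duplication formula at `(1 - s) / 2`. -/
theorem gamma_duplication {s : ℝ} (hs : s < 1) :
    2 ^ (-s) * (Real.Gamma ((1 - s) / 2) / (√Real.pi * Real.Gamma (1 - s / 2))) =
      Real.Gamma (1 - s) / Real.Gamma (1 - s / 2) ^ 2 := by
  have h := Real.Gamma_mul_Gamma_add_half ((1 - s) / 2)
  rw [show (1 - s) / 2 + 1 / 2 = 1 - s / 2 by ring, mul_div_cancel₀ _ two_ne_zero,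
    sub_sub_cancel] at h
  have h1 := Real.Gamma_pos_of_pos (by linarith : 0 < 1 - s / 2)
  have h2 := Real.sqrt_pos.2 Real.pi_pos
  have h3 : (0 : ℝ) < 2 ^ s := by positivity
  rw [Real.rpow_neg two_pos.le]
  generalize Real.Gamma (1 - s / 2) = g at *
  field_simp
  linarith

/-! ### Limits in the exponent -/

/-- Write the kernel as `A^s F(s)`. Then the quotient is `(A^s - 1)/s + A^s (F(s) - 1)/s`; the first
term tends to `log A`, the second to `0` because `F(s) - 1 = O(s²)`. -/
theorem tendsto_kernel_sub_one_div {z w : ℂ} (hz : z ∈ halfPlane) (hw : w ∈ halfPlane)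
    (h : z ≠ w ∨ 0 < w.re) :
    Tendsto (fun s : ℝ => (kernel s z w - 1) / s) (𝓝[>] 0)
      (𝓝 (Real.log (2 / (‖z - w‖ + ‖z - reflect w‖)))) := by
  have hb := norm_sub_reflect_pos hz hw h
  have ha := norm_nonneg (z - w)
  rw [add_comm ‖z - w‖]
  set A := 2 / (‖z - reflect w‖ + ‖z - w‖) with hA
  have hA0 : 0 < A := by positivity
  set C := ∑' n, Ring.multichoose (1 / 4 : ℝ) (n + 1) * Ring.multichoose (1 / 4 : ℝ) (n + 1)
  let F : ℝ → ℝ := fun s => ₂F₁ (s / 2) (s / 2) (1 : ℝ) (modulus z w ^ 2)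
  have hsmall : ∀ᶠ s : ℝ in 𝓝[>] 0, 0 < s ∧ s ≤ 1 / 2 := by
    filter_upwards [Ioc_mem_nhdsGT (by norm_num : (0 : ℝ) < 1 / 2)] with s hs using hs
  have hpow : Tendsto (fun s : ℝ => (A ^ s - 1) / s) (𝓝[>] 0) (𝓝 (Real.log A)) := by
    have hd := (Real.hasStrictDerivAt_const_rpow hA0 0).hasDerivAt
    rw [Real.rpow_zero, one_mul] at hd
    have := hd.tendsto_slope_zero_right
    simpa [div_eq_inv_mul] using this
  have hcont : Tendsto (fun s : ℝ => A ^ s) (𝓝[>] 0) (𝓝 1) := by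
    have := ((Real.continuous_const_rpow hA0.ne').tendsto 0).mono_left
      (nhdsWithin_le_nhds (s := Ioi 0))
    simpa using this
  have hF : Tendsto (fun s : ℝ => (F s - 1) / s) (𝓝[>] 0) (𝓝 0) := by
    have hlim : Tendsto (fun s : ℝ => 4 * s * C) (𝓝[>] 0) (𝓝 0) := by
      have := ((by fun_prop : Continuous fun s : ℝ => 4 * s * C).tendsto 0).mono_left
        (nhdsWithin_le_nhds (s := Ioi 0))
      simpa using this
    refine squeeze_zero' ?_ ?_ hlim
    · filter_upwards [hsmall] with s hs
      have := hypergeometric_modulus_pos hs.1 hz hw (.inr (by linarith [hs.2]))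
      exact div_nonneg (by simp only [F]; linarith) hs.1.le
    · filter_upwards [hsmall] with s hs
      have := hypergeometric_sq_sub_one_le hs.1 hs.2 (modulus_sq_mem hz hw)
      rw [div_le_iff₀ hs.1]
      simp only [F]
      linarith
  have hlim := hpow.add (hcont.mul hF)
  rw [mul_zero, add_zero] at hlim
  refine hlim.congr' ?_
  filter_upwards [hsmall] with s hs
  rw [kernel_eq hs.1 hz hw (h.imp_right fun h => ⟨by linarith [hs.2], h⟩), ← hA]
  simp only [F]
  have := hs.1.ne'
  field_simp
  ring

theorem kernel_one_eq {z w : ℂ} (hz : z ∈ halfPlane) (hw : w ∈ halfPlane) (h : z ≠ w) :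
    kernel 1 z w = 2 / Real.pi * (2 / (‖z - reflect w‖ + ‖z - w‖)) *
      ellipticK (modulus z w ^ 2) := by
  rw [kernel_eq one_pos hz hw (.inl h), ellipticK_eq (modulus_sq_mem hz hw).1
    (modulus_sq_lt_one hz hw h), Real.rpow_one]
  have := Real.pi_pos
  field_simp

theorem tendsto_kernel_exponent {z w : ℂ} (hz : z ∈ halfPlane) (hw : w ∈ halfPlane) (h : z ≠ w)
    (s₀ : ℝ) : Tendsto (fun s : ℝ => kernel s z w) (𝓝 s₀) (𝓝 (kernel s₀ z w)) := by
  simp only [kernel, extKernel_eq_mean]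
  exact tendsto_mean_toReal (norm_pos_iff.2 (sub_ne_zero.2 h))
    (norm_sub_reflect_pos hz hw (.inl h))

theorem tendsto_Gamma_nhdsGT_zero : Tendsto Real.Gamma (𝓝[>] 0) atTop := by
  have h1 : Tendsto (fun x : ℝ => Real.Gamma (x + 1)) (𝓝[>] 0) (𝓝 1) := by
    have hc : ContinuousAt Real.Gamma (0 + 1) :=
      (Real.differentiableAt_Gamma fun m => by
        have : (0 : ℝ) ≤ m := m.cast_nonneg
        linarith).continuousAt
    have := (hc.tendsto.comp ((continuous_id.add continuous_const).tendsto (0 : ℝ))).mono_left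
      (nhdsWithin_le_nhds (s := Ioi 0))
    simpa [Function.comp_def] using this
  refine (h1.pos_mul_atTop one_pos tendsto_inv_nhdsGT_zero).congr' ?_
  filter_upwards [self_mem_nhdsWithin] with x (hx : 0 < x)
  rw [Real.Gamma_add_one hx.ne']
  field_simp

/-- The closed form on the diagonal contains `Γ((1 - s) / 2)`, which has its pole at `s = 1`, times
a factor with a positive limit. -/
theorem tendsto_kernel_self_atTop {w : ℂ} (hw : 0 < w.re) :
    Tendsto (fun s : ℝ => kernel s w w) (𝓝[<] 1) atTop := by
  have hg : Tendsto (fun s : ℝ => Real.Gamma ((1 - s) / 2)) (𝓝[<] 1) atTop := by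
    refine tendsto_Gamma_nhdsGT_zero.comp (tendsto_nhdsWithin_iff.2 ⟨?_, ?_⟩)
    · have := ((by fun_prop : Continuous fun s : ℝ => (1 - s) / 2).tendsto 1).mono_left
        (nhdsWithin_le_nhds (s := Iio 1))
      simpa using this
    · filter_upwards [self_mem_nhdsWithin] with s (hs : s < 1)
      simp only [mem_Ioi]
      linarith
  have hu : 0 < 2 * |w.re| := by positivity
  have hgpos : (0 : ℝ) < Real.Gamma (1 - 1 / 2) := Real.Gamma_pos_of_pos (by norm_num)
  have hc : ContinuousAt (fun s : ℝ => (2 * |w.re|) ^ (-s) / (√Real.pi * Real.Gamma (1 - s / 2))) 1 := by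
    have h1 : ContinuousAt (fun s : ℝ => Real.Gamma (1 - s / 2)) 1 := by
      refine ContinuousAt.comp (f := fun s : ℝ => 1 - s / 2) (g := Real.Gamma) ?_ (by fun_prop)
      refine (Real.differentiableAt_Gamma fun m => ?_).continuousAt
      have : (0 : ℝ) ≤ m := m.cast_nonneg
      linarith
    have h2 : ContinuousAt (fun s : ℝ => (2 * |w.re|) ^ (-s)) 1 :=
      ((Real.continuous_const_rpow hu.ne').comp continuous_neg).continuousAt
    exact h2.div (continuousAt_const.mul h1) (by have := Real.pi_pos; positivity)
  have hpos : 0 < (2 * |w.re|) ^ (-(1 : ℝ)) / (√Real.pi * Real.Gamma (1 - 1 / 2)) := by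
    have := Real.pi_pos
    positivity
  refine ((hc.tendsto.mono_left nhdsWithin_le_nhds).pos_mul_atTop hpos hg).congr' ?_
  filter_upwards [self_mem_nhdsWithin] with s (hs : s < 1)
  have h1 := Real.Gamma_pos_of_pos (by linarith : 0 < 1 - s / 2)
  have h2 := Real.Gamma_pos_of_pos (by linarith : 0 < (1 - s) / 2)
  rw [kernel, extKernel_self, mean_zero_left_of_lt_one hs hu, ENNReal.toReal_ofReal (by positivity)]
  ring

end RieszRev

/-! ### The collected properties of the kernel -/

theorem lemma2p2 :
    -- well defined off the diagonal
    (∀ s : ℝ, 0 < s → ∀ z ∈ RieszRev.halfPlane, ∀ w ∈ RieszRev.halfPlane, z ≠ w →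
      RieszRev.extKernel s z w < ⊤) ∧
    -- symmetry
    (∀ s : ℝ, 0 < s → ∀ z ∈ RieszRev.halfPlane, ∀ w ∈ RieszRev.halfPlane,
      RieszRev.extKernel s z w = RieszRev.extKernel s w z) ∧
    -- homogeneity
    (∀ s : ℝ, 0 < s → ∀ z ∈ RieszRev.halfPlane, ∀ w ∈ RieszRev.halfPlane, ∀ r : ℝ, 0 < r →
      RieszRev.extKernel s (r * z) (r * w) =
        ENNReal.ofReal (r ^ (-s)) * RieszRev.extKernel s z w) ∧
    -- continuity off the diagonal
    (∀ s : ℝ, 0 < s → ∀ z ∈ RieszRev.halfPlane, ∀ w ∈ RieszRev.halfPlane, z ≠ w →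
      ContinuousWithinAt (fun p : ℂ × ℂ => RieszRev.kernel s p.1 p.2)
        (RieszRev.halfPlane ×ˢ RieszRev.halfPlane) (z, w)) ∧
    -- continuity on the diagonal for `0 < s < 1`
    (∀ s : ℝ, 0 < s → s < 1 → ∀ w : ℂ, 0 < w.re →
      RieszRev.extKernel s w w < ⊤ ∧
      ContinuousWithinAt (fun p : ℂ × ℂ => RieszRev.kernel s p.1 p.2)
        (RieszRev.halfPlane ×ˢ RieszRev.halfPlane) (w, w)) ∧
    -- singularity on the diagonal for `s ≥ 1`
    (∀ s : ℝ, 1 ≤ s → ∀ w ∈ RieszRev.halfPlane,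
      RieszRev.extKernel s w w = ⊤ ∧
      Tendsto (fun p : ℂ × ℂ => RieszRev.kernel s p.1 p.2)
        (𝓝[{p ∈ RieszRev.halfPlane ×ˢ RieszRev.halfPlane | p.1 ≠ p.2}] (w, w)) atTop) ∧
    -- `w` on the axis of revolution
    (∀ s : ℝ, 0 < s → ∀ w : ℂ, w.re = 0 → ∀ z ∈ RieszRev.halfPlane, z ≠ w →
      RieszRev.kernel s z w = ‖z - w‖ ^ (-s)) ∧
    -- rate of growth at the diagonal for `s > 1`
    (∀ s : ℝ, 1 < s → ∀ w : ℂ, 0 < w.re →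
      Tendsto (fun z : ℂ => ‖z - w‖ ^ (s - 1) * RieszRev.kernel s z w) (𝓝[≠] w)
        (𝓝 (Real.Gamma ((s - 1) / 2) / (√Real.pi * Real.Gamma (s / 2)) *
          (1 / ‖w - RieszRev.reflect w‖)))) ∧
    -- monotonicity along vertical lines
    (∀ s : ℝ, 0 < s → ∀ u v t t' : ℝ, 0 ≤ u → |t - v| < |t' - v| →
      RieszRev.extKernel s ⟨u, t'⟩ ⟨u, v⟩ < RieszRev.extKernel s ⟨u, t⟩ ⟨u, v⟩) ∧
    -- monotonicity along horizontal lines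
    (∀ s : ℝ, 0 < s → ∀ u y t t' : ℝ, 0 ≤ u → 0 < t → t < t' →
      RieszRev.extKernel s ⟨u, y⟩ ⟨u + t', y⟩ < RieszRev.extKernel s ⟨u, y⟩ ⟨u + t, y⟩) ∧
    -- unique global maximum at `z = w`, and its value
    (∀ s : ℝ, 0 < s → s < 1 → ∀ w : ℂ, 0 < w.re →
      (∀ z ∈ RieszRev.halfPlane, z ≠ w →
        RieszRev.extKernel s z w < RieszRev.extKernel s w w) ∧
      RieszRev.extKernel s w w = RieszRev.extKernel s (RieszRev.reflect w) w ∧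
      RieszRev.extKernel s w w =
        RieszRev.rieszEnergy s RieszRev.circleMeasure * ENNReal.ofReal (|w.re| ^ (-s))) ∧
    -- the energy of the unit circle
    (∀ s : ℝ, 0 < s → s < 1 →
      RieszRev.rieszEnergy s RieszRev.circleMeasure =
        ENNReal.ofReal (2 ^ (-s) * (Real.Gamma ((1 - s) / 2) /
          (√Real.pi * Real.Gamma (1 - s / 2)))) ∧
      RieszRev.rieszEnergy s RieszRev.circleMeasure =
        ENNReal.ofReal (Real.Gamma (1 - s) / Real.Gamma (1 - s / 2) ^ 2)) ∧
    -- the two hypergeometric representations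
    (∀ s : ℝ, 0 < s → ∀ z ∈ RieszRev.halfPlane, ∀ w ∈ RieszRev.halfPlane,
      (z ≠ w ∨ (s < 1 ∧ 0 < w.re)) →
      RieszRev.kernel s z w = ‖z - RieszRev.reflect w‖ ^ (-s) *
        ₂F₁ (s / 2) (1 / 2) (1 : ℝ) (1 - ‖z - w‖ ^ 2 / ‖z - RieszRev.reflect w‖ ^ 2) ∧
      RieszRev.kernel s z w = (2 / (‖z - RieszRev.reflect w‖ + ‖z - w‖)) ^ s *
        ₂F₁ (s / 2) (s / 2) (1 : ℝ) (RieszRev.modulus z w ^ 2)) ∧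
    -- the representation by the Legendre function of degree `s / 2 - 1` and order `0`
    (∀ s : ℝ, 0 < s →
      (∃ P : ℝ → ℝ, RieszRev.IsLegendreP (s / 2 - 1) P) ∧
      ∀ P : ℝ → ℝ, RieszRev.IsLegendreP (s / 2 - 1) P →
        ∀ z ∈ RieszRev.halfPlane, ∀ w ∈ RieszRev.halfPlane, z ≠ w →
          RieszRev.kernel s z w = ‖z - RieszRev.reflect w‖ ^ (-s / 2) * ‖z - w‖ ^ (-s / 2) *
            P (RieszRev.legendreArg z w)) ∧
    (∀ z w : ℂ, 0 < z.re → 0 < w.re → z ≠ w → 1 < RieszRev.legendreArg z w) ∧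
    -- the singularity factored out for `s > 1`
    (∀ s : ℝ, 1 < s → ∀ z ∈ RieszRev.halfPlane, ∀ w ∈ RieszRev.halfPlane, z ≠ w →
      RieszRev.kernel s z w = ‖z - w‖ ^ (1 - s) / ‖z - RieszRev.reflect w‖ *
        ₂F₁ (1 - s / 2) (1 / 2) (1 : ℝ) (1 - ‖z - w‖ ^ 2 / ‖z - RieszRev.reflect w‖ ^ 2)) ∧
    -- the limit `s → 0⁺`
    (∀ z ∈ RieszRev.halfPlane, ∀ w ∈ RieszRev.halfPlane, (z ≠ w ∨ 0 < w.re) →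
      Tendsto (fun s : ℝ => (RieszRev.kernel s z w - 1) / s) (𝓝[>] 0)
        (𝓝 (Real.log (2 / (‖z - w‖ + ‖z - RieszRev.reflect w‖))))) ∧
    -- the limit `s → 1⁻` and the kernel for `s = 1`
    (∀ z ∈ RieszRev.halfPlane, ∀ w ∈ RieszRev.halfPlane, z ≠ w →
      RieszRev.kernel 1 z w = 2 / Real.pi * (2 / (‖z - RieszRev.reflect w‖ + ‖z - w‖)) *
        RieszRev.ellipticK (RieszRev.modulus z w ^ 2) ∧
      Tendsto (fun s : ℝ => RieszRev.kernel s z w) (𝓝[<] 1)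
        (𝓝 (2 / Real.pi * (2 / (‖z - RieszRev.reflect w‖ + ‖z - w‖)) *
          RieszRev.ellipticK (RieszRev.modulus z w ^ 2)))) ∧
    (∀ w : ℂ, 0 < w.re → Tendsto (fun s : ℝ => RieszRev.kernel s w w) (𝓝[<] 1) atTop) := by
  refine ⟨fun s hs z hz w hw h => RieszRev.extKernel_lt_top hs hz hw (.inl h),
    fun s _ z _ w _ => RieszRev.extKernel_comm s z w,
    fun s _ z _ w _ r hr => RieszRev.extKernel_mul s z w hr,
    fun s hs z hz w hw h => RieszRev.continuousWithinAt_kernel hs hz hw h,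
    fun s hs0 hs1 w hw => ⟨RieszRev.extKernel_lt_top hs0 (hw.le : w ∈ RieszRev.halfPlane) hw.le
      (.inr ⟨hs1, hw⟩), RieszRev.continuousWithinAt_kernel_diag hs0 hs1 hw⟩,
    fun s hs w _ => ⟨RieszRev.extKernel_self_eq_top hs w, RieszRev.tendsto_kernel_diag_atTop hs w⟩,
    fun s hs w hw z hz h => RieszRev.kernel_of_re_eq_zero hs hz hw h,
    fun s hs w hw => RieszRev.tendsto_norm_rpow_mul_kernel hs hw,
    fun s hs u v t t' _ h => RieszRev.extKernel_lt_vertical hs h,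
    fun s hs u y t t' hu ht h => RieszRev.extKernel_lt_horizontal hs hu ht h,
    fun s hs0 hs1 w hw => ⟨fun z hz h => RieszRev.extKernel_lt_self hs0 hs1 hz hw h,
      RieszRev.extKernel_self_eq_reflect s w, RieszRev.extKernel_self_eq_rieszEnergy s hw⟩,
    fun s _ hs1 => ⟨RieszRev.rieszEnergy_circleMeasure_eq hs1, ?_⟩,
    fun s hs z hz w hw h => ⟨RieszRev.kernel_eq_half hs hz hw (h.imp_right And.right),
      RieszRev.kernel_eq hs hz hw h⟩,
    fun s hs => ⟨⟨RieszRev.legendre s, RieszRev.isLegendreP_legendre s⟩,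
      fun P hP z hz w hw h => RieszRev.kernel_eq_legendre hs hP hz hw h⟩,
    fun z w hz hw h => RieszRev.one_lt_legendreArg hz hw h,
    fun s hs z hz w hw h => RieszRev.kernel_eq_euler (by linarith) hz hw h,
    fun z hz w hw h => RieszRev.tendsto_kernel_sub_one_div hz hw h,
    fun z hz w hw h => ⟨RieszRev.kernel_one_eq hz hw h, ?_⟩,
    fun w hw => RieszRev.tendsto_kernel_self_atTop hw⟩
  · rw [RieszRev.rieszEnergy_circleMeasure_eq hs1, RieszRev.gamma_duplication hs1]
  · rw [← RieszRev.kernel_one_eq hz hw h]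
    exact (RieszRev.tendsto_kernel_exponent hz hw h 1).mono_left nhdsWithin_le_nhds
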